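/- **Setting.** For $n\ge 3$ let $G_1$ be the travelling salesman instance on the complete graph with vertex set $V=\{1,\dots,n\}$ in which the edges $\{i,i+1\}$ ($1\le i<n$) and $\{n,1\}$ have length $1$ and all other edges have length $n$. Feasible solutions are Hamiltonian cycles, the cost of a cycle is the sum of the lengths of its edges, and $s^*=(1,2,\dots,n)$ is the unique optimal solution. Consider the following cross-entropy algorithm with elite size $1$, smoothing parameter $\rho=1$, max-min calibration, and sample size $N=N(n)$. It starts from the matrix $\Pi_0$ with $\pi^0_{i,j}=\frac1{n-1}$ for $i\neq j$ and $\pi^0_{i,i}=0$. In iteration $t=0,1,2,\dots$ it draws $N$ independent random solutions according to $\Pi_t$, selects one of them of minimal cost, $X_t^{[1]}$ (ties are broken arbitrarily), and sets, for $i\ne j$, $\pi^{t+1}_{i,j}=\pi_{\max}=1-\frac1n$ if the edge $\{i,j\}$ belongs to $X_t^{[1]}$ and $\pi^{t+1}_{i,j}=\pi_{\min}=\frac{1}{n(n-2)}$ otherwise (and $\pi^{t+1}_{i,i}=0$). A random solution is drawn according to $\Pi=(\pi_{i,j})$ in one of two ways. * *Vertex-based generation:* start at a uniformly random vertex; as long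 as there are unvisited vertices, move from the current vertex $v$ to an unvisited vertex $v'$ with probability $\pi_{v,v'}/\sum_{k\text{ unvisited}}\pi_{v,k}$; finally return to the start. * *Edge-based generation:* start with $B=\emptyset$; as long as there are admissible edges, add to $B$ an admissible edge $\{i,j\}$ with probability $(\pi_{i,j}+\pi_{j,i})/\sum_{\{k,l\}\text{ admissible}}(\pi_{k,l}+\pi_{l,k})$, where an edge $e\notin B$ is admissible if $(V,B\cup\{e\})$ has neither a cycle nor a vertex of degree $\ge 3$; then $(V,B)$ is a Hamiltonian path, which is closed to a Hamiltonian cycle by the edge between its end points. **Theorem.** Let $\epsilon\in(0,1)$ and let $N=N(n)\in\Omega(n^{\epsilon})$. * a) With the vertex-based generation, the algorithm finds $s^*$ within $n^6$ iterations with probability at least $1-e^{-\Omega(N)}$. * b) With the edge-based generation, the algorithm finds $s^*$ within $n^3\ln n$ iterations with probability at least $1-e^{-\Omega(N)}$. Here "finds $s^*$ within $T$ iterations" means that $s^*$ is among the solutions drawn in the first $\lfloor T\rfloor$ iterations, and "$h(n)\in\Omega(f(n))$" means that there is a constant $c>0$ with $h(n)\ge c\,f(n)$ for all sufficiently large $n$.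 -/

import Mathlib

open Filter

noncomputable section

namespace CETSP

/-- `InOmega g f` says that `g ∈ Ω(f)`. -/
def InOmega (g f : ℕ → ℝ) : Prop :=
  ∃ c : ℝ, 0 < c ∧ ∀ᶠ n in atTop, c * f n ≤ g n

/-- Random selection from `U` with probabilities proportional to the weights `w`:
`a ∈ U` is selected with probability `w a / ∑ b ∈ U, w b`.
(If all weights vanish this rule is meaningless, and the uniform distribution is used.) -/
def pick {α : Type*} [DecidableEq α] (U : Finset α) (hU : U.Nonempty) (w : α → ℝ) : PMF α :=
  if h : ∑ b ∈ U, ENNReal.ofReal (w b) = 0 then PMF.uniformOfFinset U hU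
  else PMF.ofFinset
    (fun a => if a ∈ U then ENNReal.ofReal (w a) / ∑ b ∈ U, ENNReal.ofReal (w b) else 0) U
    (by
      rw [Finset.sum_congr rfl (fun a ha => if_pos ha)]
      simp only [div_eq_mul_inv]
      rw [← Finset.sum_mul]
      exact ENNReal.mul_inv_cancel h (ENNReal.sum_ne_top.2 fun _ _ => ENNReal.ofReal_ne_top))
    (fun a ha => if_neg ha)

/-- The law of `N` independent draws from `p`. -/
def iid {α : Type*} (p : PMF α) : (N : ℕ) → PMF (Fin N → α)
  | 0 => PMF.pure Fin.elim0
  | N + 1 => p.bind fun a => (iid p N).map fun X => Fin.cons a X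

/-- The probability of an event under a discrete law, as a real number. -/
def prob {α : Type*} (p : PMF α) (S : Set α) : ℝ := (p.toOuterMeasure S).toReal

/-! ### The travelling salesman problem on the complete graph with `n` vertices -/

/-- Sets of edges. The vertices `1, …, n` are represented by `0, …, n - 1`. A feasible solution is
identified with the edge set of its Hamiltonian cycle. -/
abbrev EdgeSet (n : ℕ) := Finset (Sym2 (Fin n))

/-- The edges of the closed tour `(i₁, i₂, …, iₙ)`, namely
`{i₁, i₂}, …, {iₙ₋₁, iₙ}, {iₙ, i₁}`. -/
def tourEdges {n : ℕ} (s : List (Fin n)) : EdgeSet n :=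
  ((s.zip (s.rotate 1)).map fun p => s(p.1, p.2)).toFinset

/-- The total travelling cost of a solution for the distance function `d`. -/
def cost {n : ℕ} (d : Sym2 (Fin n) → ℝ) (C : EdgeSet n) : ℝ := ∑ e ∈ C, d e

/-- The solution `s* = (1, 2, …, n)`, the unique optimal one for the instance `G₁` below. -/
def sStar (n : ℕ) : EdgeSet n := tourEdges (List.finRange n)

/-- The distance function of the instance `G₁`: the edges `{i, i + 1}` and `{n, 1}` have
length `1`, and all other edges have length `n`. -/
def distG1 (n : ℕ) (e : Sym2 (Fin n)) : ℝ := if e ∈ sStar n then 1 else n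

/-! ### Vertex-based random solution generation -/

/-- The `while` loop, with current vertex `v`, unvisited vertices `U` and partial solution `s`
(the first argument bounds the number of passes). -/
def vertexLoop {n : ℕ} (P : Matrix (Fin n) (Fin n) ℝ) :
    ℕ → Fin n → Finset (Fin n) → List (Fin n) → PMF (List (Fin n))
  | 0, _, _, s => PMF.pure s
  | k + 1, v, U, s =>
    if h : U.Nonempty then
      (pick U h (P v)).bind fun v' => vertexLoop P k v' (U.erase v') (s ++ [v'])
    else PMF.pure s

/-- Vertex-based generation: a uniformly random start vertex, then repeatedly an unvisited vertex
`v'` with probability `P v v' / ∑ k unvisited, P v k`, where `v` is the current vertex. -/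
def vertexGen {n : ℕ} (P : Matrix (Fin n) (Fin n) ℝ) : PMF (EdgeSet n) :=
  if h : (Finset.univ : Finset (Fin n)).Nonempty then
    (PMF.uniformOfFinset Finset.univ h).bind fun v =>
      (vertexLoop P n v (Finset.univ.erase v) [v]).map tourEdges
  else PMF.pure ∅

/-! ### Edge-based random solution generation -/

/-- The number of edges of `B` that are incident to `v`. -/
def deg {n : ℕ} (B : EdgeSet n) (v : Fin n) : ℕ := (B.filter fun e => v ∈ e).card

open Classical in
/-- The edges `e ∉ B` that are admissible by `B`: the graph with edge set `B ∪ {e}` has neither a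
cycle nor a vertex of degree at least `3`. -/
def admissible {n : ℕ} (B : EdgeSet n) : EdgeSet n :=
  Finset.univ.filter fun e =>
    ¬ e.IsDiag ∧ e ∉ B ∧
      (SimpleGraph.fromEdgeSet (↑(insert e B) : Set (Sym2 (Fin n)))).IsAcyclic ∧
      ∀ v, deg (insert e B) v < 3

/-- The weight `P i j + P j i` of the edge `{i, j}`. -/
def edgeWeight {n : ℕ} (P : Matrix (Fin n) (Fin n) ℝ) : Sym2 (Fin n) → ℝ :=
  Sym2.lift ⟨fun i j => P i j + P j i, fun _ _ => add_comm _ _⟩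

/-- The `while` loop, with current set `B` of edges (the first argument bounds the number of
passes). It stops when no edge is admissible, that is, when `B` is a Hamiltonian path. -/
def edgeLoop {n : ℕ} (P : Matrix (Fin n) (Fin n) ℝ) : ℕ → EdgeSet n → PMF (EdgeSet n)
  | 0, B => PMF.pure B
  | k + 1, B =>
    if h : (admissible B).Nonempty then
      (pick (admissible B) h (edgeWeight P)).bind fun e => edgeLoop P k (insert e B)
    else PMF.pure B

/-- Closes a Hamiltonian path to a Hamiltonian cycle, by the edge between its two end points. -/
def closePath {n : ℕ} (B : EdgeSet n) : EdgeSet n :=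
  B ∪ Finset.univ.filter fun e => ¬ e.IsDiag ∧ ∀ v, v ∈ e → deg B v = 1

/-- Edge-based generation: repeatedly an admissible edge with probability proportional to its
weight, until a Hamiltonian path is obtained, which determines the Hamiltonian cycle. -/
def edgeGen {n : ℕ} (P : Matrix (Fin n) (Fin n) ℝ) : PMF (EdgeSet n) :=
  (edgeLoop P n ∅).map closePath

/-! ### The cross entropy algorithm with max-min calibration -/

/-- The uniform initial distribution. -/
def initDist (n : ℕ) : Matrix (Fin n) (Fin n) ℝ :=
  fun i j => if i = j then 0 else 1 / ((n : ℝ) - 1)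

/-- `sort` is a rule that sorts the `N` solutions of an iteration in non-decreasing order of their
costs: the `k`-th best solution of the sample `X` is `X (sort X k)`. Ties are broken
arbitrarily. -/
def IsSortRule {n N : ℕ} (f : EdgeSet n → ℝ)
    (sort : (Fin N → EdgeSet n) → Equiv.Perm (Fin N)) : Prop :=
  ∀ X : Fin N → EdgeSet n, Monotone fun k => f (X (sort X k))

/-- The empirical distribution of the `M` best solutions: entry `(i, j)` is the fraction of them
that contain the edge `{i, j}`. -/
def empirical {n N : ℕ} (M : ℕ) (sort : (Fin N → EdgeSet n) → Equiv.Perm (Fin N))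
    (X : Fin N → EdgeSet n) : Matrix (Fin n) (Fin n) ℝ :=
  fun i j =>
    ((Finset.univ.filter fun k : Fin N => (k : ℕ) < M ∧ s(i, j) ∈ X (sort X k)).card : ℝ) / M

/-- Max-min calibration of a number. -/
def calibrate (pmin pmax x : ℝ) : ℝ :=
  if x < pmin then pmin else if pmax < x then pmax else x

/-- The next sampling distribution: smoothing with parameter `ρ`, followed by the max-min
calibration of the entries that belong to edges. -/
def nextDist {n N : ℕ} (M : ℕ) (ρ pmin pmax : ℝ)
    (sort : (Fin N → EdgeSet n) → Equiv.Perm (Fin N))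
    (P : Matrix (Fin n) (Fin n) ℝ) (X : Fin N → EdgeSet n) : Matrix (Fin n) (Fin n) ℝ :=
  fun i j => if i = j then 0
    else calibrate pmin pmax ((1 - ρ) * P i j + ρ * empirical M sort X i j)

/-- The law of the samples of `T` successive iterations of the algorithm with sample size `N`,
elite size `M`, smoothing parameter `ρ`, calibration bounds `pmin, pmax` and random solution
generation `gen`, started from the distribution `P`. -/
def ceRun {n N : ℕ} (gen : Matrix (Fin n) (Fin n) ℝ → PMF (EdgeSet n)) (M : ℕ) (ρ pmin pmax : ℝ)
    (sort : (Fin N → EdgeSet n) → Equiv.Perm (Fin N)) :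
    ℕ → Matrix (Fin n) (Fin n) ℝ → PMF (List (Fin N → EdgeSet n))
  | 0, _ => PMF.pure []
  | T + 1, P => (iid (gen P) N).bind fun X =>
      (ceRun gen M ρ pmin pmax sort T (nextDist M ρ pmin pmax sort P X)).map fun r => X :: r

/-- The probability that the algorithm with `M = 1`, `ρ = 1`, `pmin = 1 / (n (n - 2))` and
`pmax = 1 - 1 / n`, started from the uniform distribution, samples `s*` within its first `T`
iterations. -/
def successProb {n N : ℕ} (gen : Matrix (Fin n) (Fin n) ℝ → PMF (EdgeSet n))
    (sort : (Fin N → EdgeSet n) → Equiv.Perm (Fin N)) (T : ℕ) : ℝ :=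
  prob (ceRun gen 1 1 (1 / ((n : ℝ) * ((n : ℝ) - 2))) (1 - 1 / (n : ℝ)) sort T (initDist n))
    {r | ∃ X ∈ r, ∃ i, X i = sStar n}

end CETSP

end

/-! With `ρ = 1` and elite size one, the sampling matrix after an iteration depends only on the
selected tour `C`, and the cost of `C` is an increasing affine function of its excess, the number of
edges of `C` outside `sStar n`. A run is thus a random walk on tours, and two estimates for a single
draw from `tourMatrix C` suffice: it reproduces `C` with constant probability `p₀`, and it lowers
the excess `l` with probability at least `p l`. By the first, the excess rises in an iteration with
probability at most `exp (-p₀ N)`. By the second, a level `l` is not left within `τ l` iterations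
with probability at most `exp (-c N)`, provided that `p l * τ l ≥ c`. Summing over levels and
iterations (`failProb_le`) leaves a polynomial factor, which `exp` of a multiple of `N ∈ Ω(n ^ ε)`
absorbs (`successProb_ge`).

Improvements come from `exists_exchange`: for an edge `e` of `sStar n` missing in `C`, at most three
edges of `C` outside `sStar n` can be deleted so that adding `e` leaves a linear forest. Every tour
containing that forest has smaller excess, and such a tour exists because maximal linear forests are
Hamiltonian paths.

Vertex-based: following `C` loses only a factor `1 + O(1/n)` per step once a neighbour in `C` is
already visited. The improved tour has at most three new edges. Starting (probability `1/n`) so that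
one of them is the closing edge, the other two cost order `n ^ (-2)` each, so `p` has order `n ^
(-5)` and `n` levels of about `n ^ 5` iterations suffice.

Edge-based: as long as only edges of `C` are chosen, the partial solution is, up to constant
factors, bounded below by a uniform subset of `C`. When its size `t` lies between `n/4` and `n/2`, a
constant fraction of these subsets is compatible with the exchange for a given `e`. Choosing `e`
next has probability of order `n ^ (-3)`, and finishing correctly has probability of order `1/n`,
because at most one wrong edge of `C` competes. Summing over order `n` sizes `t` and all `excess C`
edges `e` gives `p l` of order `l / n ^ 3`, and the harmonic sum produces the logarithm. -/

noncomputable section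

namespace CETSP

variable {n : ℕ}

/-! ### Linear forests -/

/-- The simple graph with edge set `B`. -/
abbrev graph {n : ℕ} (B : EdgeSet n) : SimpleGraph (Fin n) :=
  SimpleGraph.fromEdgeSet (↑B : Set (Sym2 (Fin n)))

/-- A set of edges forming a disjoint union of paths. -/
structure LinForest {n : ℕ} (B : EdgeSet n) : Prop where
  not_isDiag : ∀ e ∈ B, ¬ e.IsDiag
  acyclic : (graph B).IsAcyclic
  deg_lt : ∀ v, deg B v < 3

variable {B B' : EdgeSet n}

theorem deg_mono (h : B ⊆ B') (v : Fin n) : deg B v ≤ deg B' v :=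
  Finset.card_le_card (Finset.filter_subset_filter _ h)

theorem deg_insert {e : Sym2 (Fin n)} (he : e ∉ B) (v : Fin n) :
    deg (insert e B) v = deg B v + if v ∈ e then 1 else 0 := by
  unfold deg
  rw [Finset.filter_insert]
  split_ifs with h
  · rw [Finset.card_insert_of_notMem (by simp [he])]
  · rfl

theorem graph_mono (h : B ⊆ B') : graph B ≤ graph B' :=
  SimpleGraph.fromEdgeSet_mono (by exact_mod_cast h)

theorem LinForest.mono (h : LinForest B') (hB : B ⊆ B') : LinForest B :=
  ⟨fun e he => h.1 e (hB he), h.2.anti (graph_mono hB), fun v => (deg_mono hB v).trans_lt (h.3 v)⟩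

theorem LinForest.empty : LinForest (∅ : EdgeSet n) :=
  ⟨by simp, by simp [graph], by simp [deg]⟩

theorem mem_admissible_iff (h : LinForest B) {e : Sym2 (Fin n)} :
    e ∈ admissible B ↔ e ∉ B ∧ LinForest (insert e B) := by
  simp only [admissible, Finset.mem_filter, Finset.mem_univ, true_and]
  constructor
  · rintro ⟨h1, h2, h3, h4⟩
    refine ⟨h2, ?_, h3, h4⟩
    intro e' he'
    rcases Finset.mem_insert.1 he' with rfl | h'
    exacts [h1, h.1 _ h']
  · rintro ⟨h1, h2⟩
    exact ⟨h2.1 e (Finset.mem_insert_self _ _), h1, h2.2, h2.3⟩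

theorem graph_insert (u v : Fin n) : graph (insert s(u, v) B) = graph B ⊔ SimpleGraph.edge u v := by
  ext x y
  simp only [SimpleGraph.fromEdgeSet_adj, Finset.coe_insert, Set.mem_insert_iff,
    SimpleGraph.sup_adj, SimpleGraph.edge_adj, Finset.mem_coe, Sym2.eq_iff]
  tauto

theorem isAcyclic_graph_insert {u v : Fin n} (h : (graph B).IsAcyclic)
    (huv : ¬ (graph B).Reachable u v) : (graph (insert s(u, v) B)).IsAcyclic := by
  rw [graph_insert]
  exact h.sup_edge_of_not_reachable huv

theorem LinForest.insert_edge {u v : Fin n} (h : LinForest B) (huv : ¬ (graph B).Reachable u v)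
    (hu : deg B u < 2) (hv : deg B v < 2) : LinForest (insert s(u, v) B) := by
  have hne : u ≠ v := by rintro rfl; exact huv (SimpleGraph.Reachable.refl _)
  have hnot : s(u, v) ∉ B := fun hm =>
    huv (SimpleGraph.Adj.reachable (by simp [SimpleGraph.fromEdgeSet_adj, hm, hne]))
  refine ⟨?_, isAcyclic_graph_insert h.2 huv, fun w => ?_⟩
  · intro e he
    rcases Finset.mem_insert.1 he with rfl | h'
    exacts [by simpa using hne, h.1 _ h']
  · rw [deg_insert hnot]
    have := h.3 w
    split_ifs with hw
    · rcases Sym2.mem_iff.1 hw with rfl | rfl <;> omega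
    · omega

/-- An acyclic graph extends to a spanning tree of the complete graph, which has `n - 1` edges. -/
theorem card_add_one_le (hn : 0 < n) (hd : ∀ e ∈ B, ¬ e.IsDiag) (h : (graph B).IsAcyclic) :
    B.card + 1 ≤ n := by
  classical
  have : NeZero n := ⟨hn.ne'⟩
  have hc : (⊤ : SimpleGraph (Fin n)).Connected := SimpleGraph.connected_top
  obtain ⟨T, hT1, -, hT⟩ := hc.exists_isTree_le_of_le_of_isAcyclic le_top h
  have := hT.card_edgeFinset
  rw [Fintype.card_fin] at this
  refine le_trans (Nat.add_le_add_right (Finset.card_le_card fun e he => ?_) 1) this.le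
  rw [SimpleGraph.mem_edgeFinset]
  refine SimpleGraph.edgeSet_mono hT1 ?_
  rw [SimpleGraph.edgeSet_fromEdgeSet]
  exact ⟨he, hd e he⟩

theorem LinForest.card_add_one_le (h : LinForest B) (hn : 0 < n) : B.card + 1 ≤ n :=
  CETSP.card_add_one_le hn h.1 h.2

/-- In a finite acyclic graph some vertex of each component has degree at most one. -/
theorem exists_reachable_deg_lt_two (hd : ∀ e ∈ B, ¬ e.IsDiag) (h : (graph B).IsAcyclic)
    (v : Fin n) : ∃ w, (graph B).Reachable v w ∧ deg B w < 2 := by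
  classical
  let S : Set ℕ := {k | ∃ w, ∃ p : (graph B).Walk v w, p.IsPath ∧ p.length = k}
  have hS : S.Nonempty := ⟨0, v, SimpleGraph.Walk.nil, by simp, rfl⟩
  have hb : BddAbove S := by
    refine ⟨n, ?_⟩
    rintro k ⟨w, p, hp, rfl⟩
    have := hp.length_lt
    rw [Fintype.card_fin] at this
    exact this.le
  -- The end `w` of a longest path from `v` works: a neighbour off the path would prolong it, and by
  -- acyclicity a neighbour on the path is the penultimate vertex.
  obtain ⟨w, p, hp, hk⟩ := Nat.sSup_mem hS hb
  refine ⟨w, ⟨p⟩, ?_⟩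
  by_contra hdeg
  have hdeg : 1 < (B.filter fun e => w ∈ e).card := by unfold deg at hdeg; omega
  obtain ⟨e1, he1, e2, he2, hne⟩ := Finset.one_lt_card.1 hdeg
  have key : ∀ e ∈ B.filter (fun e => w ∈ e), e = s(w, p.penultimate) := by
    intro e he
    obtain ⟨heB, hwe⟩ := Finset.mem_filter.1 he
    obtain ⟨y, rfl⟩ := hwe
    have hadj : (graph B).Adj w y := by
      rw [SimpleGraph.fromEdgeSet_adj]
      exact ⟨heB, by simpa using hd _ heB⟩
    by_cases hy : y ∈ p.support
    · rw [← h.eq_penultimate_of_adj_end hp hadj hy]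
    · have : (p.concat hadj).length ∈ S := ⟨y, _, hp.concat hy hadj, rfl⟩
      have := le_csSup hb this
      rw [SimpleGraph.Walk.length_concat, hk] at this
      omega
  exact hne ((key e1 he1).trans (key e2 he2).symm)

/-- If there were two components, each would have a vertex of degree at most one, and the edge
joining these would be admissible. -/
theorem reachable_of_admissible_eq_empty (h : LinForest B) (ha : admissible B = ∅)
    (u v : Fin n) : (graph B).Reachable u v := by
  obtain ⟨u', hu, hdu⟩ := exists_reachable_deg_lt_two h.1 h.2 u
  obtain ⟨v', hv, hdv⟩ := exists_reachable_deg_lt_two h.1 h.2 v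
  by_contra hr
  have hr' : ¬ (graph B).Reachable u' v' := fun h' => hr (hu.trans (h'.trans hv.symm))
  have hne : u' ≠ v' := by rintro rfl; exact hr' (SimpleGraph.Reachable.refl _)
  have : s(u', v') ∈ admissible B := (mem_admissible_iff h).2
    ⟨fun hm => hr' (SimpleGraph.Adj.reachable (by simp [SimpleGraph.fromEdgeSet_adj, hm, hne])),
      h.insert_edge hr' hdu hdv⟩
  simp [ha] at this

/-! ### Paths and tours given by lists of vertices -/

/-- The edges of the path that visits the vertices of a list in order. -/
def pathEdges : List (Fin n) → EdgeSet n
  | [] => ∅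
  | [_] => ∅
  | a :: b :: l => insert s(a, b) (pathEdges (b :: l))

theorem mem_of_mem_pathEdges : ∀ {l : List (Fin n)} {e : Sym2 (Fin n)} {v : Fin n},
    e ∈ pathEdges l → v ∈ e → v ∈ l
  | [], e, v, h, _ => by simp [pathEdges] at h
  | [_], e, v, h, _ => by simp [pathEdges] at h
  | a :: b :: l, e, v, h, hv => by
    rw [pathEdges, Finset.mem_insert] at h
    rcases h with rfl | h
    · rcases Sym2.mem_iff.1 hv with rfl | rfl <;> simp
    · exact List.mem_cons_of_mem _ (mem_of_mem_pathEdges h hv)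

theorem not_reachable_of_deg_eq_zero {u v : Fin n} (hu : ∀ e ∈ B, u ∉ e) (hne : u ≠ v) :
    ¬ (graph B).Reachable u v := by
  rintro ⟨w⟩
  cases w with
  | nil => exact hne rfl
  | cons h _ =>
    rw [SimpleGraph.fromEdgeSet_adj] at h
    exact hu _ h.1 (by simp)

theorem isDiag_of_mem_pathEdges : ∀ {l : List (Fin n)}, l.Nodup → ∀ e ∈ pathEdges l, ¬ e.IsDiag
  | [], _ => by simp [pathEdges]
  | [_], _ => by simp [pathEdges]
  | a :: b :: l, h => by
    intro e he
    rw [pathEdges, Finset.mem_insert] at he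
    rcases he with rfl | he
    · have := (List.nodup_cons.1 h).1
      simp only [Sym2.mk_isDiag_iff]
      rintro rfl
      simp at this
    · exact isDiag_of_mem_pathEdges (List.nodup_cons.1 h).2 e he

theorem isAcyclic_pathEdges : ∀ {l : List (Fin n)}, l.Nodup → (graph (pathEdges l)).IsAcyclic
  | [], _ => by simp [pathEdges, graph]
  | [_], _ => by simp [pathEdges, graph]
  | a :: b :: l, h => by
    rw [pathEdges]
    have ha := (List.nodup_cons.1 h).1
    refine isAcyclic_graph_insert (isAcyclic_pathEdges (List.nodup_cons.1 h).2) ?_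
    refine not_reachable_of_deg_eq_zero (fun e he hae => ha (mem_of_mem_pathEdges he hae)) ?_
    rintro rfl
    simp at ha

theorem card_pathEdges : ∀ {l : List (Fin n)}, l.Nodup → (pathEdges l).card = l.length - 1
  | [], _ => by simp [pathEdges]
  | [_], _ => by simp [pathEdges]
  | a :: b :: l, h => by
    have ha := (List.nodup_cons.1 h).1
    rw [pathEdges, Finset.card_insert_of_notMem, card_pathEdges (List.nodup_cons.1 h).2]
    · simp
    · exact fun hm => ha (mem_of_mem_pathEdges hm (by simp))

theorem pathEdges_subset_of_isChain : ∀ {l : List (Fin n)}, l.IsChain (graph B).Adj →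
    pathEdges l ⊆ B
  | [], _ => by simp [pathEdges]
  | [_], _ => by simp [pathEdges]
  | a :: b :: l, h => by
    rw [List.isChain_cons_cons] at h
    rw [pathEdges, Finset.insert_subset_iff]
    have := h.1
    rw [SimpleGraph.fromEdgeSet_adj] at this
    exact ⟨by exact_mod_cast this.1, pathEdges_subset_of_isChain h.2⟩

/-- Turns the zip with the rotated list into a recursive form: the path together with one closing
edge. -/
theorem zip_append_singleton_toFinset : ∀ (a : Fin n) (l : List (Fin n)) (c : Fin n),
    (((a :: l).zip (l ++ [c])).map fun p => s(p.1, p.2)).toFinset =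
      insert s((a :: l).getLast (by simp), c) (pathEdges (a :: l))
  | a, [], c => by simp [pathEdges]
  | a, b :: l, c => by
    have := zip_append_singleton_toFinset b l c
    rw [pathEdges, List.cons_append, List.zip_cons_cons, List.map_cons, List.toFinset_cons, this,
      List.getLast_cons (List.cons_ne_nil b l)]
    exact Finset.insert_comm _ _ _

theorem tourEdges_cons (a : Fin n) (l : List (Fin n)) :
    tourEdges (a :: l) = insert s((a :: l).getLast (by simp), a) (pathEdges (a :: l)) := by
  rw [← zip_append_singleton_toFinset]
  simp [tourEdges]

theorem tourEdges_rotate_one (l : List (Fin n)) : tourEdges (l.rotate 1) = tourEdges l := by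
  have h : ((l.rotate 1).zip ((l.rotate 1).rotate 1)) = (l.zip (l.rotate 1)).rotate 1 :=
    (List.zipWith_rotate_distrib _ _ _ _ (by simp)).symm
  ext e
  simp only [tourEdges, List.mem_toFinset, h, List.mem_map, List.mem_rotate]

theorem tourEdges_rotate (l : List (Fin n)) (k : ℕ) : tourEdges (l.rotate k) = tourEdges l := by
  induction k with
  | zero => simp
  | succ k ih => rw [← List.rotate_rotate, tourEdges_rotate_one, ih]

/-! ### Hamiltonian cycles -/

/-- The edge sets of Hamiltonian cycles. -/
def IsTour (C : EdgeSet n) : Prop := ∃ l : List (Fin n), l.Nodup ∧ (∀ v, v ∈ l) ∧ C = tourEdges l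

theorem exists_append_of_mem_pathEdges : ∀ {l : List (Fin n)} {e : Sym2 (Fin n)},
    e ∈ pathEdges l → ∃ l₁ u v l₂, l = l₁ ++ u :: v :: l₂ ∧ e = s(u, v)
  | [], e, h => by simp [pathEdges] at h
  | [_], e, h => by simp [pathEdges] at h
  | a :: b :: l, e, h => by
    rw [pathEdges, Finset.mem_insert] at h
    rcases h with rfl | h
    · exact ⟨[], a, b, l, rfl, rfl⟩
    · obtain ⟨l₁, u, v, l₂, h1, h2⟩ := exists_append_of_mem_pathEdges h
      exact ⟨a :: l₁, u, v, l₂, by rw [h1]; rfl, h2⟩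

theorem IsTour.exists_cons {C : EdgeSet n} (hC : IsTour C) (v : Fin n) :
    ∃ l, (v :: l).Nodup ∧ (∀ w, w ∈ v :: l) ∧ C = tourEdges (v :: l) := by
  obtain ⟨l, hl, hm, rfl⟩ := hC
  obtain ⟨l₁, l₂, rfl⟩ := List.append_of_mem (hm v)
  refine ⟨l₂ ++ l₁, ?_, ?_, ?_⟩
  · have := List.nodup_rotate (n := l₁.length).2 hl
    rwa [List.rotate_append_length_eq] at this
  · intro w
    have := hm w
    simp only [List.mem_append, List.mem_cons] at this ⊢
    tauto
  · rw [← tourEdges_rotate _ l₁.length, List.rotate_append_length_eq]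
    rfl

theorem length_eq_of_spanning {l : List (Fin n)} (hl : l.Nodup) (hm : ∀ v, v ∈ l) :
    l.length = n := by
  rw [← List.toFinset_card_of_nodup hl, show l.toFinset = Finset.univ by ext; simp [hm]]
  simp

theorem getLast_ne_of_cons_cons {a b : Fin n} {l : List (Fin n)} (hl : (a :: b :: l).Nodup) :
    (a :: b :: l).getLast (by simp) ≠ a := by
  rw [List.getLast_cons (by simp)]
  intro h
  exact (List.nodup_cons.1 hl).1 (h ▸ List.getLast_mem _)

/-- Three vertices are essential: on two vertices the closing edge is the path edge itself. -/
theorem closing_notMem {a b c : Fin n} {l : List (Fin n)} (hl : (a :: b :: c :: l).Nodup) :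
    s((a :: b :: c :: l).getLast (by simp), a) ∉ pathEdges (a :: b :: c :: l) := by
  rw [pathEdges, Finset.mem_insert, not_or]
  have h1 := getLast_ne_of_cons_cons hl
  constructor
  · rw [Sym2.eq_iff]
    rintro (⟨h, -⟩ | ⟨h, -⟩)
    · exact h1 h
    · rw [List.getLast_cons (by simp)] at h
      exact getLast_ne_of_cons_cons (List.nodup_cons.1 hl).2 h
  · exact fun h => (List.nodup_cons.1 hl).1 (mem_of_mem_pathEdges h (by simp))

theorem exists_cons_cons_cons {l : List (Fin n)} (h : 3 ≤ l.length) :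
    ∃ a b c l', l = a :: b :: c :: l' := by
  match l, h with
  | a :: b :: c :: l', _ => exact ⟨a, b, c, l', rfl⟩

theorem IsTour.isDiag {C : EdgeSet n} (hC : IsTour C) (hn : 3 ≤ n) : ∀ e ∈ C, ¬ e.IsDiag := by
  obtain ⟨l, hl, hm, rfl⟩ := hC
  obtain ⟨a, b, c, l', rfl⟩ :=
    exists_cons_cons_cons (l := l) (by rw [length_eq_of_spanning hl hm]; exact hn)
  intro e he
  rw [tourEdges_cons, Finset.mem_insert] at he
  rcases he with rfl | he
  · simpa using getLast_ne_of_cons_cons hl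
  · exact isDiag_of_mem_pathEdges hl e he

theorem IsTour.card {C : EdgeSet n} (hC : IsTour C) (hn : 3 ≤ n) : C.card = n := by
  obtain ⟨l, hl, hm, rfl⟩ := hC
  have hlen := length_eq_of_spanning hl hm
  obtain ⟨a, b, c, l', rfl⟩ := exists_cons_cons_cons (l := l) (by omega)
  rw [tourEdges_cons, Finset.card_insert_of_notMem (closing_notMem hl), card_pathEdges hl]
  omega

/-- After rotating the tour to start at `v`, the only edges at `v` are the first path edge and the
closing edge. -/
theorem IsTour.deg_eq {C : EdgeSet n} (hC : IsTour C) (hn : 3 ≤ n) (v : Fin n) : deg C v = 2 := by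
  obtain ⟨l, hl, hm, rfl⟩ := hC.exists_cons v
  have hlen := length_eq_of_spanning hl hm
  obtain ⟨a, b, c, l', h⟩ := exists_cons_cons_cons (l := v :: l) (by omega)
  obtain ⟨rfl, rfl⟩ : v = a ∧ l = b :: c :: l' := by simpa using h
  have hz : (deg (pathEdges (b :: c :: l')) v) = 0 := by
    rw [deg, Finset.card_eq_zero, Finset.filter_eq_empty_iff]
    exact fun e he hv => (List.nodup_cons.1 hl).1 (mem_of_mem_pathEdges he hv)
  have h1 := closing_notMem hl
  rw [tourEdges_cons, deg_insert h1, pathEdges, deg_insert, hz]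
  · simp
  · exact fun hm => (List.nodup_cons.1 hl).1 (mem_of_mem_pathEdges hm (by simp))

/-- Every edge of a tour can be taken as the closing edge. -/
theorem IsTour.exists_closing {C : EdgeSet n} (hC : IsTour C) {e : Sym2 (Fin n)} (he : e ∈ C) :
    ∃ a l, (a :: l).Nodup ∧ (∀ w, w ∈ a :: l) ∧ C = tourEdges (a :: l) ∧
      e = s((a :: l).getLast (by simp), a) := by
  obtain ⟨l, hl, hm, rfl⟩ := hC
  cases l with
  | nil => simp [tourEdges] at he
  | cons a l =>
    rw [tourEdges_cons, Finset.mem_insert] at he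
    rcases he with rfl | he
    · exact ⟨a, l, hl, hm, rfl, rfl⟩
    · obtain ⟨l₁, u, v, l₂, h1, h2⟩ := exists_append_of_mem_pathEdges he
      have h3 : a :: l = (l₁ ++ [u]) ++ (v :: l₂) := by rw [h1]; simp
      rw [h3] at hl hm ⊢
      refine ⟨v, l₂ ++ (l₁ ++ [u]), ?_, ?_, ?_, ?_⟩
      · have := List.nodup_rotate (n := (l₁ ++ [u]).length).2 hl
        rwa [List.rotate_append_length_eq] at this
      · intro w
        have := hm w
        simp only [List.mem_append, List.mem_cons] at this ⊢
        tauto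
      · rw [← tourEdges_rotate _ (l₁ ++ [u]).length, List.rotate_append_length_eq]
        rfl
      · rw [h2]
        simp

/-- The sharper bound at the head is what the induction needs: prepending a vertex adds one edge
there. -/
theorem deg_pathEdges_le {l : List (Fin n)} (hl : l.Nodup) (v : Fin n) :
    deg (pathEdges l) v ≤ 2 ∧ (l.head? = some v → deg (pathEdges l) v ≤ 1) := by
  induction l with
  | nil => simp [pathEdges, CETSP.deg]
  | cons a l ih =>
    cases l with
    | nil => simp [pathEdges, CETSP.deg]
    | cons b l =>
      have ih := ih (List.nodup_cons.1 hl).2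
      have ha := (List.nodup_cons.1 hl).1
      have hz : ∀ e ∈ pathEdges (b :: l), a ∉ e := fun e he hv => ha (mem_of_mem_pathEdges he hv)
      rw [pathEdges, deg_insert (fun hm => hz _ hm (by simp))]
      have hz' : deg (pathEdges (b :: l)) a = 0 := by
        rw [deg, Finset.card_eq_zero, Finset.filter_eq_empty_iff]
        exact fun e he => hz e he
      constructor
      · split_ifs with hv
        · rcases Sym2.mem_iff.1 hv with rfl | rfl
          · omega
          · have := ih.2 rfl
            omega
        · have := ih.1
          omega
      · intro h
        obtain rfl : a = v := by simpa using h
        split_ifs <;> omega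

theorem linForest_pathEdges {l : List (Fin n)} (hl : l.Nodup) : LinForest (pathEdges l) :=
  ⟨isDiag_of_mem_pathEdges hl, isAcyclic_pathEdges hl,
    fun v => Nat.lt_succ_of_le (deg_pathEdges_le hl v).1⟩

/-- A tour without one of its edges is a linear forest. -/
theorem IsTour.linForest {C : EdgeSet n} (hC : IsTour C) {e : Sym2 (Fin n)}
    (he : e ∈ C) (hB : B ⊆ C) (heB : e ∉ B) : LinForest B := by
  obtain ⟨a, l, hl, hm, rfl, rfl⟩ := hC.exists_closing he
  refine (linForest_pathEdges hl).mono fun x hx => ?_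
  have := hB hx
  rw [tourEdges_cons, Finset.mem_insert] at this
  rcases this with rfl | h
  exacts [absurd hx heB, h]

theorem IsTour.linForest_of_ssubset {C : EdgeSet n} (hC : IsTour C)
    (hB : B ⊂ C) : LinForest B := by
  obtain ⟨e, he, heB⟩ := Finset.exists_of_ssubset hB
  exact hC.linForest he hB.1 heB

/-! ### Maximal linear forests and Hamiltonian paths -/

/-- A maximal linear forest is a Hamiltonian path. -/
theorem exists_eq_pathEdges (h : LinForest B) (ha : admissible B = ∅) (hn : 0 < n) :
    ∃ l : List (Fin n), l.Nodup ∧ (∀ v, v ∈ l) ∧ B = pathEdges l := by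
  let S : Set ℕ := {k | ∃ l : List (Fin n), l.Nodup ∧ l.IsChain (graph B).Adj ∧ l.length = k}
  have hS : S.Nonempty := ⟨0, [], by simp⟩
  have hb : BddAbove S := by
    refine ⟨n, ?_⟩
    rintro k ⟨l, hl, -, rfl⟩
    simpa using hl.length_le_card
  obtain ⟨l, hl, hc, hk⟩ := Nat.sSup_mem hS hb
  have hmax : ∀ l' : List (Fin n), l'.Nodup → l'.IsChain (graph B).Adj → l'.length ≤ l.length :=
    fun l' h1 h2 => hk ▸ le_csSup hb ⟨l', h1, h2, rfl⟩
  have hspan : ∀ v, v ∈ l := by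
    by_contra! hv
    obtain ⟨v, hv⟩ := hv
    have hne : l ≠ [] := by
      rintro rfl
      have := hmax [v] (by simp) (by simp)
      simp at this
    obtain ⟨u, hu⟩ := List.exists_mem_of_ne_nil l hne
    obtain ⟨w⟩ := reachable_of_admissible_eq_empty h ha u v
    -- By connectedness some edge leaves a longest path `l`, from `x` on it to `y` off it. If `x` is
    -- an end of `l`, then `y` prolongs the path; otherwise `x` has its two path neighbours and `y`,
    -- hence degree three.
    obtain ⟨d, -, hd1, hd2⟩ := w.exists_boundary_dart {x | x ∈ l} hu hv
    obtain ⟨⟨x, y⟩, hxy⟩ := d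
    simp only [Set.mem_ofPred_eq] at hd1 hd2 hxy
    obtain ⟨l₁, l₂, rfl⟩ := List.append_of_mem hd1
    rcases List.eq_nil_or_concat l₁ with rfl | ⟨l₁, x', rfl⟩
    · have := hmax (y :: ([] ++ x :: l₂)) (List.nodup_cons.2 ⟨hd2, hl⟩)
        (by simpa using ⟨hxy.symm, hc⟩)
      simp at this
    · cases l₂ with
      | nil =>
        have := hmax ((l₁.concat x' ++ [x]) ++ [y])
          (List.nodup_append.2 ⟨hl, by simp, by
            rintro a ha b hb rfl
            obtain rfl : a = y := by simpa using hb
            exact hd2 ha⟩)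
          (List.isChain_append.2 ⟨hc, by simp, by
            have := hxy
            rw [SimpleGraph.fromEdgeSet_adj] at this
            simpa using this⟩)
        simp at this
      | cons x'' l₂ =>
        have e1 : l₁.concat x' ++ x :: x'' :: l₂ = l₁ ++ (x' :: x :: x'' :: l₂) := by simp
        rw [e1] at hl hc hd2
        have hc' := (List.isChain_append.1 hc).2.1
        rw [List.isChain_cons_cons, List.isChain_cons_cons] at hc'
        have hl' := (List.nodup_append.1 hl).2.1
        have h3 := h.3 x
        have hsub : {s(x, x'), s(x, x''), s(x, y)} ⊆ B.filter fun e => x ∈ e := by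
          have a1 := hc'.1.symm
          have a2 := hc'.2.1
          have a3 := hxy
          rw [SimpleGraph.fromEdgeSet_adj] at a1 a2 a3
          intro e he
          simp only [Finset.mem_insert, Finset.mem_singleton] at he
          rw [Finset.mem_filter]
          rcases he with rfl | rfl | rfl
          · exact ⟨a1.1, by simp⟩
          · exact ⟨a2.1, by simp⟩
          · exact ⟨a3.1, by simp⟩
        have hle := Finset.card_le_card hsub
        rw [Finset.card_eq_three.2 ⟨_, _, _, ?_, ?_, ?_, rfl⟩] at hle
        · exact absurd h3 (by unfold CETSP.deg; omega)
        · simp only [List.nodup_cons, List.mem_cons, not_or] at hl'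
          rw [Ne, Sym2.congr_right]
          exact hl'.1.2.1
        · rw [Ne, Sym2.congr_right]
          rintro rfl
          simp at hd2
        · rw [Ne, Sym2.congr_right]
          rintro rfl
          simp at hd2
  -- The spanning path has `n - 1` edges, the maximum for a forest, so it exhausts `B`.
  refine ⟨l, hl, hspan, (Finset.eq_of_subset_of_card_le (pathEdges_subset_of_isChain hc) ?_).symm⟩
  have := h.card_add_one_le hn
  rw [card_pathEdges hl, length_eq_of_spanning hl hspan]
  omega

/-- All degrees in the tour are two, so dropping the closing edge leaves degree one exactly at its
two end points. -/
theorem closePath_pathEdges {l : List (Fin n)} (hl : l.Nodup) (hm : ∀ v, v ∈ l) (hn : 3 ≤ n) :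
    closePath (pathEdges l) = tourEdges l := by
  have hT : IsTour (tourEdges l) := ⟨l, hl, hm, rfl⟩
  have hlen := length_eq_of_spanning hl hm
  obtain ⟨a, b, c, l', rfl⟩ := exists_cons_cons_cons (l := l) (by omega)
  have hne := getLast_ne_of_cons_cons hl
  have h1 := closing_notMem hl
  have hd : ∀ v, deg (pathEdges (a :: b :: c :: l')) v = 1 ↔
      v ∈ s((a :: b :: c :: l').getLast (by simp), a) := by
    intro v
    have := hT.deg_eq hn v
    rw [tourEdges_cons, deg_insert h1] at this
    split_ifs at this with h
    · simp only [h, iff_true]; omega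
    · simp only [h, iff_false]; omega
  rw [closePath, tourEdges_cons, Finset.insert_eq, Finset.union_comm]
  congr 1
  ext e
  simp only [hd, Finset.mem_filter, Finset.mem_univ, true_and, Finset.mem_singleton]
  constructor
  · rintro ⟨h2, h3⟩
    induction e with
    | h x y =>
      have hx := h3 x (by simp)
      have hy := h3 y (by simp)
      rw [Sym2.mk_isDiag_iff] at h2
      rw [Sym2.mem_iff] at hx hy
      rw [Sym2.eq_iff]
      grind
  · rintro rfl
    exact ⟨by simpa using hne, fun v hv => hv⟩

/-- Closing a maximal linear forest yields a tour. -/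
theorem isTour_closePath (h : LinForest B) (ha : admissible B = ∅) (hn : 3 ≤ n) :
    IsTour (closePath B) := by
  obtain ⟨l, hl, hm, rfl⟩ := exists_eq_pathEdges h ha (by omega)
  exact ⟨l, hl, hm, closePath_pathEdges hl hm hn⟩

theorem subset_closePath : B ⊆ closePath B := Finset.subset_union_left

theorem isTour_sStar : IsTour (sStar n) := ⟨List.finRange n, List.nodup_finRange n, by simp, rfl⟩

theorem exists_maximal_linForest {B : EdgeSet n} (h : LinForest B) (hn : 0 < n) :
    ∃ B', B ⊆ B' ∧ LinForest B' ∧ admissible B' = ∅ := by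
  by_cases ha : admissible B = ∅
  · exact ⟨B, subset_rfl, h, ha⟩
  · obtain ⟨e, he⟩ := Finset.nonempty_iff_ne_empty.2 ha
    obtain ⟨he1, he2⟩ := (mem_admissible_iff h).1 he
    have hlt : n - (insert e B).card < n - B.card := by
      have := he2.card_add_one_le hn
      rw [Finset.card_insert_of_notMem he1] at *
      omega
    obtain ⟨B', h1, h2, h3⟩ := exists_maximal_linForest he2 hn
    exact ⟨B', (Finset.subset_insert _ _).trans h1, h2, h3⟩
termination_by n - B.card

theorem LinForest.exists_tour (h : LinForest B) (hn : 3 ≤ n) : ∃ C, IsTour C ∧ B ⊆ C := by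
  obtain ⟨B', h1, h2, h3⟩ := exists_maximal_linForest h (by omega)
  exact ⟨_, isTour_closePath h2 h3 hn, h1.trans subset_closePath⟩

/-! ### Exchanging edges of a tour -/

/-- The number of edges of `C` that are not used by the optimal tour. -/
def excess (C : EdgeSet n) : ℕ := (C \ sStar n).card

theorem IsTour.eq_of_subset {C C' : EdgeSet n} (hC : IsTour C) (hC' : IsTour C') (hn : 3 ≤ n)
    (h : C ⊆ C') : C = C' :=
  Finset.eq_of_subset_of_card_le h (by rw [hC.card hn, hC'.card hn])

theorem IsTour.excess_eq_zero_iff {C : EdgeSet n} (hC : IsTour C) (hn : 3 ≤ n) :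
    excess C = 0 ↔ C = sStar n := by
  rw [excess, Finset.card_eq_zero, Finset.sdiff_eq_empty_iff_subset]
  exact ⟨hC.eq_of_subset isTour_sStar hn, fun h => h ▸ subset_rfl⟩

theorem IsTour.excess_add {C : EdgeSet n} (hC : IsTour C) (hn : 3 ≤ n) :
    excess C + (C ∩ sStar n).card = n := by
  rw [excess, Finset.card_sdiff_add_card_inter, hC.card hn]

theorem IsTour.card_sStar_sdiff {C : EdgeSet n} (hC : IsTour C) (hn : 3 ≤ n) :
    (sStar n \ C).card = excess C := by
  have h1 := Finset.card_sdiff_add_card_inter (sStar n) C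
  have h2 := hC.excess_add hn
  rw [isTour_sStar.card hn, Finset.inter_comm] at h1
  omega

/-- All tours have `n` edges, and each edge outside the optimal tour costs `n - 1` more than one
inside. Hence comparing costs is comparing excesses. -/
theorem IsTour.cost_eq {C : EdgeSet n} (hC : IsTour C) (hn : 3 ≤ n) :
    cost (distG1 n) C = n + ((n : ℝ) - 1) * excess C := by
  have h : ∀ e ∈ C, distG1 n e = 1 + if e ∉ sStar n then (n : ℝ) - 1 else 0 := by
    intro e _
    unfold distG1
    split_ifs <;> simp_all
  rw [cost, Finset.sum_congr rfl h, Finset.sum_add_distrib, ← Finset.sum_filter,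
    Finset.filter_notMem_eq_sdiff]
  simp only [Finset.sum_const, nsmul_eq_mul, hC.card hn, excess]
  ring

theorem IsTour.excess_le_of_cost_le {C C' : EdgeSet n} (hC : IsTour C) (hC' : IsTour C')
    (hn : 3 ≤ n) (h : cost (distG1 n) C' ≤ cost (distG1 n) C) : excess C' ≤ excess C := by
  rw [hC.cost_eq hn, hC'.cost_eq hn] at h
  have hn' : (3 : ℝ) ≤ n := by exact_mod_cast hn
  have : (excess C' : ℝ) ≤ excess C := by
    by_contra! hlt
    nlinarith
  exact_mod_cast this

/-! ### Improving exchanges -/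

theorem deg_lt_two {C : EdgeSet n} (hC : IsTour C) (hn : 3 ≤ n) (hB : B ⊆ C) {a : Sym2 (Fin n)}
    {i : Fin n} (ha : a ∈ C) (haB : a ∉ B) (hi : i ∈ a) : deg B i < 2 := by
  rw [← hC.deg_eq hn i]
  refine Finset.card_lt_card (Finset.ssubset_iff_subset_ne.2
    ⟨Finset.filter_subset_filter _ hB, fun h => haB ?_⟩)
  have : a ∈ C.filter fun e => i ∈ e := by simp [ha, hi]
  rw [← h] at this
  exact (Finset.mem_filter.1 this).1

theorem not_reachable_of_isAcyclic_insert {u v : Fin n} (huv : u ≠ v) (h : s(u, v) ∉ B)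
    (hB : (graph (insert s(u, v) B)).IsAcyclic) : ¬ (graph B).Reachable u v := by
  rw [graph_insert, SimpleGraph.isAcyclic_sup_fromEdgeSet_iff] at hB
  intro hr
  rcases hB.2 hr with h' | h'
  · exact huv h'
  · rw [SimpleGraph.fromEdgeSet_adj] at h'
    exact h h'.1

theorem mem_of_mem_edges {u v : Fin n} {w : (graph B).Walk u v} {d : Sym2 (Fin n)}
    (hd : d ∈ w.edges) : d ∈ B := by
  have := w.edges_subset_edgeSet hd
  rw [SimpleGraph.edgeSet_fromEdgeSet] at this
  exact this.1

/-- Paths in a forest are unique: a path avoiding `d` would differ from `w`, which uses `d`. -/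
theorem not_reachable_erase (h : (graph B').IsAcyclic) (hBB : B ⊆ B') {u v : Fin n}
    {w : (graph B).Walk u v} (hw : w.IsPath) {d : Sym2 (Fin n)} (hd : d ∈ w.edges) :
    ¬ (graph (B'.erase d)).Reachable u v := by
  classical
  rintro ⟨w'⟩
  have hle : graph (B'.erase d) ≤ graph B' := graph_mono (Finset.erase_subset _ _)
  have := (SimpleGraph.isAcyclic_iff_subsingleton_path.1 h u v).elim
    ⟨w.mapLe (graph_mono hBB), hw.mapLe (graph_mono hBB)⟩
    ⟨(w'.bypass).mapLe hle, (w'.bypass_isPath).mapLe hle⟩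
  have he := congrArg (fun p => SimpleGraph.Walk.edges p) (Subtype.mk.inj this)
  simp only [SimpleGraph.Walk.edges_mapLe_eq_edges] at he
  rw [he] at hd
  have := mem_of_mem_edges hd
  simp at this

/-- The tour `C` has two edges at `i`. Were both optimal, they and `e` would give `sStar n` degree
three at `i`. -/
theorem IsTour.exists_edges_at {C : EdgeSet n} (hC : IsTour C) (hn : 3 ≤ n) {e : Sym2 (Fin n)}
    (he : e ∈ sStar n) (heC : e ∉ C) {i : Fin n} (hi : i ∈ e) :
    ∃ a ∈ C, ∃ p ∈ C, a ≠ p ∧ i ∈ a ∧ i ∈ p ∧ a ∉ sStar n := by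
  obtain ⟨a, p, hne, hap⟩ := Finset.card_eq_two.1 (hC.deg_eq hn i)
  have ha : a ∈ C.filter fun e => i ∈ e := by simp [hap]
  have hp : p ∈ C.filter fun e => i ∈ e := by simp [hap]
  rw [Finset.mem_filter] at ha hp
  by_cases h1 : a ∈ sStar n
  · by_cases h2 : p ∈ sStar n
    · exfalso
      have hs := (isTour_sStar (n := n)).deg_eq hn i
      have hsub : {a, p, e} ⊆ (sStar n).filter fun e => i ∈ e := by
        intro x hx
        simp only [Finset.mem_insert, Finset.mem_singleton] at hx
        rw [Finset.mem_filter]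
        rcases hx with rfl | rfl | rfl
        exacts [⟨h1, ha.2⟩, ⟨h2, hp.2⟩, ⟨he, hi⟩]
      have := Finset.card_le_card hsub
      rw [Finset.card_eq_three.2 ⟨a, p, e, hne, by rintro rfl; exact heC ha.1,
        by rintro rfl; exact heC hp.1, rfl⟩] at this
      unfold deg at hs
      omega
    · exact ⟨p, hp.1, a, ha.1, hne.symm, hp.2, ha.2, h2⟩
  · exact ⟨a, ha.1, p, hp.1, hne, ha.2, hp.2, h1⟩

/-- The data of an improving exchange: at most three edges `D` of `C`, none of them in the optimal
tour, can be replaced by the edge `e` of the optimal tour. At each end point of `e` there is one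
edge of `C` that is kept (`p`, `q`) and one that is removed. -/
structure Exchange (C : EdgeSet n) (e : Sym2 (Fin n)) where
  (D : EdgeSet n) (a b p q : Sym2 (Fin n)) (i j : Fin n)
  e_eq : e = s(i, j)
  e_mem : e ∈ sStar n
  e_notMem : e ∉ C
  subset : D ⊆ C \ sStar n
  card_le : D.card ≤ 3
  a_mem : a ∈ D
  b_mem : b ∈ D
  p_mem : p ∈ C \ D
  q_mem : q ∈ C \ D
  ia : i ∈ a
  ip : i ∈ p
  jb : j ∈ b
  jq : j ∈ q
  ab : a ≠ b
  pq : p ≠ q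
  linForest : LinForest (insert e (C \ D))

/-- Delete a non-optimal edge of `C` at each end of `e`, namely `a` at `i` and `b` at `j`. If this
does not separate `i` from `j`, the path still joining them contains a non-optimal edge `d`, for
otherwise it would close a cycle with `e` inside a proper subset of `sStar n`; so `d` is deleted as
well. If `d` is one of the edges `p`, `q` meant to stay at `i` and `j`, it takes the place of `a` or
`b`, which is restored, so that one edge of `C` is kept at each end. -/
theorem exists_exchange {C : EdgeSet n} (hC : IsTour C) (hn : 3 ≤ n) {e : Sym2 (Fin n)}
    (he : e ∈ sStar n) (heC : e ∉ C) : Nonempty (Exchange C e) := by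
  induction e with
  | h i j =>
  have hij : i ≠ j := by simpa using isTour_sStar.isDiag hn _ he
  obtain ⟨a, haC, p, hpC, hap, hia, hip, has⟩ := hC.exists_edges_at hn he heC (i := i) (by simp)
  obtain ⟨b, hbC, q, hqC, hbq, hjb, hjq, hbs⟩ := hC.exists_edges_at hn he heC (i := j) (by simp)
  have hne : ∀ {x y}, x ∈ C → i ∈ x → j ∈ y → x ≠ y := by
    -- An edge containing both `i` and `j` is `e`, which is not in `C`.
    rintro x _ hx h1 h2 rfl
    exact heC ((Sym2.mem_and_mem_iff hij).1 ⟨h1, h2⟩ ▸ hx)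
  have hLF : ∀ {D : EdgeSet n} {a b}, a ∈ C → i ∈ a → a ∈ D → b ∈ C → j ∈ b → b ∈ D →
      ¬ (graph (C \ D)).Reachable i j → LinForest (insert s(i, j) (C \ D)) := by
    intro D a b ha hi haD hb hj hbD hr
    exact (hC.linForest ha Finset.sdiff_subset (by simp [haD])).insert_edge hr
      (deg_lt_two hC hn Finset.sdiff_subset ha (by simp [haD]) hi)
      (deg_lt_two hC hn Finset.sdiff_subset hb (by simp [hbD]) hj)
  have hab := hne haC hia hjb
  have hpq := hne hpC hip hjq
  have haq := hne haC hia hjq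
  have hpb := hne hpC hip hjb
  by_cases hr : (graph (C \ {a, b})).Reachable i j
  · classical
    obtain ⟨w'⟩ := hr
    obtain ⟨w, hw⟩ : ∃ w : (graph (C \ {a, b})).Walk i j, w.IsPath := ⟨_, w'.bypass_isPath⟩
    obtain ⟨d, hdw, hds⟩ : ∃ d ∈ w.edges, d ∉ sStar n := by
      by_contra! hall
      -- Counting: `sStar n` without `e` has `n - 1` edges, but `C \ {a, b}` only `n - 2`. Since `w`
      -- avoids `e'`, the forest `sStar n` without `e'` would contain both `w` and `e`, hence a
      -- cycle.
      obtain ⟨e', he', he'2⟩ : ∃ e' ∈ (sStar n).erase s(i, j), e' ∉ C \ {a, b} := by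
        by_contra! hsub
        have h1 := Finset.card_le_card (show (sStar n).erase s(i, j) ⊆ C \ {a, b} from hsub)
        rw [Finset.card_erase_of_mem he, isTour_sStar.card hn, Finset.card_sdiff_of_subset
          (by simp [Finset.insert_subset_iff, haC, hbC]), hC.card hn, Finset.card_pair hab] at h1
        omega
      rw [Finset.mem_erase] at he'
      have hac : LinForest (insert s(i, j) (((sStar n).erase e').erase s(i, j))) := by
        refine isTour_sStar.linForest he'.2 ?_ (by simp [he'.1])
        simp only [Finset.insert_subset_iff, he, true_and]
        exact (Finset.erase_subset _ _).trans (Finset.erase_subset _ _)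
      refine not_reachable_of_isAcyclic_insert hij (by simp) hac.2 ⟨w.transfer _ ?_⟩
      intro x hx
      have hxF := mem_of_mem_edges hx
      rw [SimpleGraph.edgeSet_fromEdgeSet]
      refine ⟨?_, hC.isDiag hn x (Finset.mem_sdiff.1 hxF).1⟩
      simp only [Finset.mem_coe, Finset.mem_erase]
      refine ⟨?_, ?_, hall x hx⟩
      · rintro rfl
        exact heC (Finset.mem_sdiff.1 hxF).1
      · rintro rfl
        exact he'2 hxF
    have hdF := mem_of_mem_edges hdw
    simp only [Finset.mem_sdiff, Finset.mem_insert, Finset.mem_singleton, not_or] at hdF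
    by_cases hdp : d = p
    · subst hdp
      refine ⟨⟨{d, b}, d, b, a, q, i, j, rfl, he, heC, ?_, ?_, by simp, by simp, ?_, ?_, hip, hia,
        hjb, hjq, hpb, haq, hLF hpC hip (by simp) hbC hjb (by simp) ?_⟩⟩
      · simp [Finset.insert_subset_iff, hpC, hbC, hds, hbs]
      · exact Finset.card_le_two.trans (by norm_num)
      · simp [haC, hap, hab]
      · simp [hqC, hpq.symm, hbq.symm]
      · have := not_reachable_erase (B' := C.erase b) (hC.linForest hbC (Finset.erase_subset _ _)
          (by simp)).2 (by intro x; simp; tauto) hw hdw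
        convert this using 2
        ext x
        simp
        tauto
    by_cases hdq : d = q
    · subst hdq
      refine ⟨⟨{a, d}, a, d, p, b, i, j, rfl, he, heC, ?_, ?_, by simp, by simp, ?_, ?_, hia, hip,
        hjq, hjb, haq, hpb, hLF haC hia (by simp) hqC hjq (by simp) ?_⟩⟩
      · simp [Finset.insert_subset_iff, haC, hqC, hds, has]
      · exact Finset.card_le_two.trans (by norm_num)
      · simp [hpC, hap.symm, hpq]
      · simp [hbC, hab.symm, hbq]
      · have := not_reachable_erase (B' := C.erase a) (hC.linForest haC (Finset.erase_subset _ _)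
          (by simp)).2 (by intro x; simp; tauto) hw hdw
        convert this using 2
        ext x
        simp
        tauto
    refine ⟨⟨{a, b, d}, a, b, p, q, i, j, rfl, he, heC, ?_, Finset.card_le_three, by simp, by simp,
      ?_, ?_, hia, hip, hjb, hjq, hab, hpq, hLF haC hia (by simp) hbC hjb (by simp) ?_⟩⟩
    · simp [Finset.insert_subset_iff, haC, hbC, has, hbs, hds, hdF.1]
    · simp [hpC, hap.symm, hpb, Ne.symm hdp]
    · simp [hqC, haq.symm, hbq.symm, Ne.symm hdq]
    · have := not_reachable_erase (hC.linForest haC (B := C \ {a, b}) Finset.sdiff_subset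
        (by simp)).2 subset_rfl hw hdw
      convert this using 2
      ext x
      simp
      tauto
  · refine ⟨⟨{a, b}, a, b, p, q, i, j, rfl, he, heC, ?_, ?_, by simp, by simp, ?_, ?_, hia, hip,
      hjb, hjq, hab, hpq, hLF haC hia (by simp) hbC hjb (by simp) hr⟩⟩
    · simp [Finset.insert_subset_iff, haC, hbC, has, hbs]
    · exact Finset.card_le_two.trans (by norm_num)
    · simp [hpC, hap.symm, hpb]
    · simp [hqC, haq.symm, hbq.symm]

/-- The deleted edges are all non-optimal, so `C'` keeps every optimal edge of `C` and gains `e`. -/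
theorem Exchange.excess_lt {C C' : EdgeSet n} {e : Sym2 (Fin n)} (E : Exchange C e)
    (hC : IsTour C) (hC' : IsTour C') (hn : 3 ≤ n) (h : insert e (C \ E.D) ⊆ C') :
    excess C' < excess C := by
  have h1 := hC.excess_add hn
  have h2 := hC'.excess_add hn
  have h3 : insert e (C ∩ sStar n) ⊆ C' ∩ sStar n := by
    intro x hx
    rw [Finset.mem_insert, Finset.mem_inter] at hx
    rw [Finset.mem_inter]
    rcases hx with rfl | hx
    · exact ⟨h (by simp), E.e_mem⟩
    · refine ⟨h (Finset.mem_insert_of_mem (Finset.mem_sdiff.2 ⟨hx.1, fun hD => ?_⟩)), hx.2⟩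
      exact (Finset.mem_sdiff.1 (E.subset hD)).2 hx.2
  have h4 := Finset.card_le_card h3
  rw [Finset.card_insert_of_notMem (by simp [E.e_notMem])] at h4
  omega

/-- A tour that is not optimal can be improved by exchanging at most three edges. -/
theorem IsTour.exists_improvement {C : EdgeSet n} (hC : IsTour C) (hn : 3 ≤ n)
    (hne : C ≠ sStar n) : ∃ C', IsTour C' ∧ excess C' < excess C ∧ (C' \ C).card ≤ 3 := by
  have h0 : 0 < (sStar n \ C).card := by
    rw [hC.card_sStar_sdiff hn, Nat.pos_iff_ne_zero, Ne, hC.excess_eq_zero_iff hn]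
    exact hne
  obtain ⟨e, he⟩ := Finset.card_pos.1 h0
  rw [Finset.mem_sdiff] at he
  obtain ⟨E⟩ := exists_exchange hC hn he.1 he.2
  obtain ⟨C', hC', hsub⟩ := E.linForest.exists_tour hn
  refine ⟨C', hC', E.excess_lt hC hC' hn hsub, ?_⟩
  have h1 := Finset.card_sdiff_add_card_inter C' C
  have h2 : C \ E.D ⊆ C' ∩ C := fun x hx =>
    Finset.mem_inter.2 ⟨hsub (Finset.mem_insert_of_mem hx), (Finset.mem_sdiff.1 hx).1⟩
  have h3 := Finset.card_le_card h2
  rw [Finset.card_sdiff_of_subset (E.subset.trans Finset.sdiff_subset), hC.card hn] at h3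
  rw [hC'.card hn] at h1
  have := E.card_le
  omega

/-! ### Counting admissible edges -/

theorem sum_deg (hd : ∀ e ∈ B, ¬ e.IsDiag) : ∑ v, deg B v = 2 * B.card := by
  simp only [deg, Finset.card_filter]
  rw [Finset.sum_comm, mul_comm, ← smul_eq_mul, ← Finset.sum_const]
  refine Finset.sum_congr rfl fun e he => ?_
  rw [← Finset.card_filter]
  induction e with
  | h x y =>
    have hxy : x ≠ y := by simpa using hd _ he
    rw [← Finset.card_pair hxy]
    congr 1
    ext z
    simp

/-- Both ends of an admissible edge have degree below two. The degree deficits `2 - deg B v` sum to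
`2 * m`, so there are at most `2 * m` such vertices. -/
theorem LinForest.card_admissible_le (h : LinForest B) {m : ℕ} (hm : B.card + m = n) :
    (admissible B).card ≤ 4 * m ^ 2 := by
  set U := Finset.univ.filter fun v => deg B v < 2 with hU
  have h1 : U.card ≤ 2 * m := by
    have h2 : ∑ v, (deg B v + if deg B v < 2 then 1 else 0) ≤ ∑ _v : Fin n, 2 := by
      refine Finset.sum_le_sum fun v _ => ?_
      have := h.3 v
      split_ifs <;> omega
    rw [Finset.sum_add_distrib, sum_deg h.1, ← Finset.card_filter, ← hU] at h2
    simp only [Finset.sum_const, Finset.card_univ, Fintype.card_fin, smul_eq_mul] at h2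
    omega
  have h2 : admissible B ⊆ (U ×ˢ U).image fun p => s(p.1, p.2) := by
    intro e he
    obtain ⟨heB, heL⟩ := (mem_admissible_iff h).1 he
    induction e with
    | h x y =>
      refine Finset.mem_image.2 ⟨(x, y), ?_, rfl⟩
      have hx := heL.3 x
      have hy := heL.3 y
      rw [deg_insert heB, if_pos (by simp)] at hx hy
      simp only [hU, Finset.mem_product, Finset.mem_filter, Finset.mem_univ, true_and]
      omega
  calc (admissible B).card ≤ (U ×ˢ U).card := (Finset.card_le_card h2).trans Finset.card_image_le
    _ = U.card * U.card := Finset.card_product _ _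
    _ ≤ (2 * m) * (2 * m) := Nat.mul_le_mul h1 h1
    _ = 4 * m ^ 2 := by ring

/-! ### Probabilities of events -/

section Prob
variable {α β : Type*}

theorem prob_le_one (p : PMF α) (S : Set α) : prob p S ≤ 1 := by
  have h : p.toOuterMeasure S ≤ 1 := by
    rw [PMF.toOuterMeasure_apply, ← p.tsum_coe]
    exact ENNReal.tsum_le_tsum fun x => Set.indicator_le_self _ _ _
  exact ENNReal.toReal_mono ENNReal.one_ne_top h

theorem toOuterMeasure_ne_top (p : PMF α) (S : Set α) : p.toOuterMeasure S ≠ ⊤ := by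
  have h : p.toOuterMeasure S ≤ 1 := by
    rw [PMF.toOuterMeasure_apply, ← p.tsum_coe]
    exact ENNReal.tsum_le_tsum fun x => Set.indicator_le_self _ _ _
  exact ne_top_of_le_ne_top ENNReal.one_ne_top h

theorem prob_nonneg (p : PMF α) (S : Set α) : 0 ≤ prob p S := ENNReal.toReal_nonneg

theorem prob_mono (p : PMF α) {S T : Set α} (h : ∀ x ∈ p.support, x ∈ S → x ∈ T) :
    prob p S ≤ prob p T :=
  ENNReal.toReal_mono (toOuterMeasure_ne_top _ _)
    (p.toOuterMeasure_mono fun x hx => h x hx.2 hx.1)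

theorem prob_eq_one (p : PMF α) {S : Set α} (h : ∀ x ∈ p.support, x ∈ S) : prob p S = 1 := by
  rw [prob, (p.toOuterMeasure_apply_eq_one_iff S).2 h, ENNReal.toReal_one]

theorem prob_add_prob_compl (p : PMF α) (S : Set α) : prob p S + prob p Sᶜ = 1 := by
  rw [prob, prob, ← ENNReal.toReal_add (toOuterMeasure_ne_top _ _) (toOuterMeasure_ne_top _ _),
    PMF.toOuterMeasure_apply, PMF.toOuterMeasure_apply, ← ENNReal.tsum_add]
  have h : ∀ x, S.indicator p x + Sᶜ.indicator p x = p x := by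
    intro x
    exact congrFun (Set.indicator_self_add_compl S p) x
  rw [tsum_congr h, p.tsum_coe, ENNReal.toReal_one]

theorem prob_map (p : PMF α) (f : α → β) (S : Set β) : prob (p.map f) S = prob p (f ⁻¹' S) := by
  rw [prob, PMF.toOuterMeasure_map_apply]
  rfl

theorem prob_bind [Fintype α] (p : PMF α) (f : α → PMF β) (S : Set β) :
    prob (p.bind f) S = ∑ a, (p a).toReal * prob (f a) S := by
  rw [prob, PMF.toOuterMeasure_bind_apply, tsum_fintype, ENNReal.toReal_sum]
  · simp only [ENNReal.toReal_mul, prob]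
  · exact fun a _ => ENNReal.mul_ne_top (p.apply_ne_top a) (toOuterMeasure_ne_top _ _)

theorem sum_toReal [Fintype α] (p : PMF α) : ∑ a, (p a).toReal = 1 := by
  rw [← ENNReal.toReal_sum fun a _ => p.apply_ne_top a, ← tsum_fintype (L := .unconditional α),
    p.tsum_coe, ENNReal.toReal_one]

theorem prob_eq_sum [Fintype α] (p : PMF α) (S : Set α) [DecidablePred (· ∈ S)] :
    prob p S = ∑ a, (p a).toReal * if a ∈ S then 1 else 0 := by
  rw [prob, PMF.toOuterMeasure_apply, tsum_fintype, ENNReal.toReal_sum]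
  · refine Finset.sum_congr rfl fun a _ => ?_
    by_cases h : a ∈ S <;> simp [h]
  · intro a _
    by_cases h : a ∈ S <;> simp [h, p.apply_ne_top]

theorem prob_pure_of_mem {a : α} {S : Set α} (h : a ∈ S) : prob (PMF.pure a) S = 1 :=
  prob_eq_one _ fun x hx => by simp_all

section Pick
variable [DecidableEq α]

theorem mem_of_mem_support_pick {U : Finset α} {hU : U.Nonempty} {w : α → ℝ} {a : α}
    (h : a ∈ (pick U hU w).support) : a ∈ U := by
  unfold pick at h
  split_ifs at h
  · simpa using h
  · by_contra ha
    rw [PMF.mem_support_iff, PMF.ofFinset_apply] at h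
    simp [ha] at h

theorem toReal_pick {U : Finset α} (hU : U.Nonempty) {w : α → ℝ} (hw : ∀ a ∈ U, 0 ≤ w a)
    (hpos : 0 < ∑ b ∈ U, w b) {a : α} (ha : a ∈ U) :
    (pick U hU w a).toReal = w a / ∑ b ∈ U, w b := by
  have hs : ∑ b ∈ U, ENNReal.ofReal (w b) = ENNReal.ofReal (∑ b ∈ U, w b) :=
    (ENNReal.ofReal_sum_of_nonneg hw).symm
  unfold pick
  rw [dif_neg (by rw [hs, ENNReal.ofReal_eq_zero]; exact hpos.not_ge), PMF.ofFinset_apply, if_pos ha,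
    hs, ENNReal.toReal_div, ENNReal.toReal_ofReal (hw a ha), ENNReal.toReal_ofReal hpos.le]

theorem prob_pick_bind [Fintype α] {U : Finset α} (hU : U.Nonempty) {w : α → ℝ}
    (hw : ∀ a ∈ U, 0 ≤ w a) (hpos : 0 < ∑ b ∈ U, w b) (f : α → PMF β) (S : Set β) :
    prob ((pick U hU w).bind f) S = ∑ a ∈ U, w a / (∑ b ∈ U, w b) * prob (f a) S := by
  rw [prob_bind, ← Finset.sum_subset (Finset.subset_univ U)]
  · exact Finset.sum_congr rfl fun a ha => by rw [toReal_pick hU hw hpos ha]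
  · intro a _ ha
    have : pick U hU w a = 0 := by
      by_contra h
      exact ha (mem_of_mem_support_pick ((PMF.mem_support_iff _ _).2 h))
    simp [this]

end Pick

theorem mem_support_iid {p : PMF α} : ∀ {N : ℕ} {X : Fin N → α}, X ∈ (iid p N).support →
    ∀ i, X i ∈ p.support
  | 0, _, _, i => i.elim0
  | N + 1, X, h, i => by
    rw [iid, PMF.mem_support_bind_iff] at h
    obtain ⟨a, ha, h⟩ := h
    rw [PMF.mem_support_map_iff] at h
    obtain ⟨Y, hY, rfl⟩ := h
    cases i using Fin.cases with
    | zero => exact ha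
    | succ i => exact mem_support_iid hY i

theorem prob_iid_forall [Fintype α] (p : PMF α) (S : Set α) (N : ℕ) :
    prob (iid p N) {X | ∀ i, X i ∈ S} = prob p S ^ N := by
  classical
  induction N with
  | zero => rw [pow_zero, iid, prob_pure_of_mem (by simp)]
  | succ N ih =>
    rw [iid, prob_bind, pow_succ', prob_eq_sum p S, Finset.sum_mul]
    refine Finset.sum_congr rfl fun a _ => ?_
    rw [prob_map, mul_assoc]
    congr 1
    by_cases ha : a ∈ S
    · rw [if_pos ha, one_mul, ← prob_eq_sum p S, ← ih]
      congr 1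
      ext Y
      simp [Fin.forall_fin_succ, ha]
    · rw [if_neg ha, zero_mul]
      have : (fun X : Fin N → α => (Fin.cons a X : Fin (N + 1) → α)) ⁻¹' {X | ∀ i, X i ∈ S} = ∅ := by
        ext Y
        simp [Fin.forall_fin_succ, ha]
      rw [this]
      simp [prob]

end Prob

/-! ### The sampling distribution determined by a tour -/

/-- The sampling distribution after an iteration with best solution `C`. -/
def tourMatrix (C : EdgeSet n) : Matrix (Fin n) (Fin n) ℝ := fun i j =>
  if i = j then 0 else if s(i, j) ∈ C then 1 - 1 / (n : ℝ) else 1 / ((n : ℝ) * ((n : ℝ) - 2))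

/-- With smoothing parameter one the old matrix is forgotten, and with one elite sample the
empirical entries are zero or one, so calibration clips each to one of the two bounds. -/
theorem nextDist_eq_tourMatrix (hn : 3 ≤ n) {N : ℕ} (hN : 0 < N)
    (sort : (Fin N → EdgeSet n) → Equiv.Perm (Fin N)) (P : Matrix (Fin n) (Fin n) ℝ)
    (X : Fin N → EdgeSet n) :
    nextDist 1 1 (1 / ((n : ℝ) * ((n : ℝ) - 2))) (1 - 1 / (n : ℝ)) sort P X =
      tourMatrix (X (sort X ⟨0, hN⟩)) := by
  have hn' : (3 : ℝ) ≤ n := by exact_mod_cast hn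
  have h1 : 0 < 1 / ((n : ℝ) * ((n : ℝ) - 2)) :=
    div_pos one_pos (mul_pos (by linarith) (by linarith))
  have h2 : 1 / ((n : ℝ) * ((n : ℝ) - 2)) ≤ 1 := by
    rw [div_le_one (mul_pos (by linarith) (by linarith))]
    nlinarith
  have h3 : 0 < 1 / (n : ℝ) := div_pos one_pos (by linarith)
  have h4 : 1 / (n : ℝ) < 1 := by
    rw [div_lt_one (by linarith)]
    linarith
  ext i j
  unfold nextDist tourMatrix
  split_ifs with hij hC
  · rfl
  · have : empirical 1 sort X i j = 1 := by
      have : (Finset.univ.filter fun k : Fin N => (k : ℕ) < 1 ∧ s(i, j) ∈ X (sort X k)) =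
          {⟨0, hN⟩} := by
        ext k
        simp only [Finset.mem_filter, Finset.mem_univ, true_and, Finset.mem_singleton, Nat.lt_one_iff]
        constructor
        · rintro ⟨h, -⟩
          exact Fin.ext h
        · rintro rfl
          exact ⟨rfl, hC⟩
      rw [empirical, this]
      simp
    rw [this, calibrate]
    norm_num
    rw [if_neg, if_pos]
    · simpa using h3
    · simp only [one_div, mul_inv] at h2 ⊢
      linarith
  · have : empirical 1 sort X i j = 0 := by
      have : (Finset.univ.filter fun k : Fin N => (k : ℕ) < 1 ∧ s(i, j) ∈ X (sort X k)) = ∅ := by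
        ext k
        simp only [Finset.mem_filter, Finset.mem_univ, true_and, Finset.notMem_empty, iff_false,
          Nat.lt_one_iff, not_and]
        intro h
        obtain rfl : k = ⟨0, hN⟩ := Fin.ext h
        exact hC
      rw [empirical, this]
      simp
    rw [this, calibrate, if_pos]
    simpa using h1

/-! ### Generated solutions are tours -/

theorem nodup_of_mem_support_vertexLoop (P : Matrix (Fin n) (Fin n) ℝ) :
    ∀ (k : ℕ) (v : Fin n) (U : Finset (Fin n)) (s l : List (Fin n)),
      l ∈ (vertexLoop P k v U s).support → U.card ≤ k → s.Nodup → (∀ v ∈ s, v ∉ U) →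
        l.Nodup ∧ ∀ v, v ∈ l ↔ v ∈ s ∨ v ∈ U
  | 0, v, U, s, l => by
    intro h hU hs _
    obtain rfl : l = s := by simpa [vertexLoop] using h
    obtain rfl : U = ∅ := by simpa using hU
    exact ⟨hs, by simp⟩
  | k + 1, v, U, s, l => by
    intro h hU hs hd
    rw [vertexLoop] at h
    split_ifs at h with hne
    · rw [PMF.mem_support_bind_iff] at h
      obtain ⟨x, hx, h⟩ := h
      have hxU := mem_of_mem_support_pick hx
      obtain ⟨h1, h2⟩ := nodup_of_mem_support_vertexLoop P k x (U.erase x) (s ++ [x]) l h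
        (by rw [Finset.card_erase_of_mem hxU]; omega)
        (List.nodup_append.2 ⟨hs, by simp, by
          intro a ha b hb
          obtain rfl : b = x := by simpa using hb
          rintro rfl
          exact hd _ ha hxU⟩)
        (by
          intro y hy
          rw [List.mem_append, List.mem_singleton] at hy
          rcases hy with hy | rfl
          · exact fun h => hd y hy (Finset.mem_of_mem_erase h)
          · simp)
      refine ⟨h1, fun y => ?_⟩
      rw [h2, List.mem_append, List.mem_singleton, Finset.mem_erase]
      by_cases hyx : y = x
      · subst hyx; simp [hxU]
      · simp [hyx]
    · obtain rfl : l = s := by simpa using h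
      rw [Finset.not_nonempty_iff_eq_empty] at hne
      subst hne
      exact ⟨hs, by simp⟩

theorem isTour_of_mem_support_vertexGen (hn : 3 ≤ n) (P : Matrix (Fin n) (Fin n) ℝ)
    {C : EdgeSet n} (hC : C ∈ (vertexGen P).support) : IsTour C := by
  have : NeZero n := ⟨by omega⟩
  rw [vertexGen, dif_pos Finset.univ_nonempty, PMF.mem_support_bind_iff] at hC
  obtain ⟨v, -, hC⟩ := hC
  rw [PMF.mem_support_map_iff] at hC
  obtain ⟨l, hl, rfl⟩ := hC
  obtain ⟨h1, h2⟩ := nodup_of_mem_support_vertexLoop P n v _ [v] l hl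
    ((Finset.card_le_univ _).trans (by simp)) (by simp) (by simp)
  exact ⟨l, h1, fun w => by rw [h2]; simp; tauto, rfl⟩

/-- A linear forest has at most `n - 1` edges, so under `n ≤ k + B.card + 1` the bound on the number
of passes never cuts the loop short. -/
theorem mem_support_edgeLoop (P : Matrix (Fin n) (Fin n) ℝ) (hn : 0 < n) :
    ∀ (k : ℕ) (B B' : EdgeSet n), LinForest B → n ≤ k + B.card + 1 →
      B' ∈ (edgeLoop P k B).support → B ⊆ B' ∧ LinForest B' ∧ admissible B' = ∅
  | 0, B, B' => by
    intro h hk hB'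
    obtain rfl : B' = B := by simpa [edgeLoop] using hB'
    refine ⟨subset_rfl, h, ?_⟩
    by_contra hne
    obtain ⟨e, he⟩ := Finset.nonempty_iff_ne_empty.2 hne
    obtain ⟨he1, he2⟩ := (mem_admissible_iff h).1 he
    have := he2.card_add_one_le hn
    rw [Finset.card_insert_of_notMem he1] at this
    omega
  | k + 1, B, B' => by
    intro h hk hB'
    rw [edgeLoop] at hB'
    split_ifs at hB' with hne
    · rw [PMF.mem_support_bind_iff] at hB'
      obtain ⟨e, he, hB'⟩ := hB'
      obtain ⟨he1, he2⟩ := (mem_admissible_iff h).1 (mem_of_mem_support_pick he)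
      obtain ⟨h1, h2⟩ := mem_support_edgeLoop P hn k _ B' he2
        (by rw [Finset.card_insert_of_notMem he1]; omega) hB'
      exact ⟨(Finset.subset_insert _ _).trans h1, h2⟩
    · obtain rfl : B' = B := by simpa using hB'
      exact ⟨subset_rfl, h, Finset.not_nonempty_iff_eq_empty.1 hne⟩

theorem isTour_of_mem_support_edgeGen (hn : 3 ≤ n) (P : Matrix (Fin n) (Fin n) ℝ)
    {C : EdgeSet n} (hC : C ∈ (edgeGen P).support) : IsTour C := by
  rw [edgeGen, PMF.mem_support_map_iff] at hC
  obtain ⟨B, hB, rfl⟩ := hC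
  obtain ⟨-, h1, h2⟩ := mem_support_edgeLoop P (by omega) n ∅ B LinForest.empty (by omega) hB
  exact isTour_closePath h1 h2 hn

/-! ### Vertex-based generation -/

theorem IsTour.card_neighbors_le {C : EdgeSet n} (hC : IsTour C) (hn : 3 ≤ n) (v : Fin n) :
    (Finset.univ.filter fun x => s(v, x) ∈ C).card ≤ 2 := by
  rw [← hC.deg_eq hn v]
  refine Finset.card_le_card_of_injOn (fun x => s(v, x)) ?_ ?_
  · intro x hx
    simp only [Finset.coe_filter, Finset.mem_univ, true_and, Set.mem_ofPred_eq] at hx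
    simp [hx]
  · intro x _ y _ h
    exact Sym2.congr_right.1 h

theorem tourMatrix_nonneg (C : EdgeSet n) (hn : 3 ≤ n) (v x : Fin n) : 0 ≤ tourMatrix C v x := by
  have hn' : (3 : ℝ) ≤ n := by exact_mod_cast hn
  have h4 : 1 / (n : ℝ) < 1 := by
    rw [div_lt_one (by linarith)]
    linarith
  unfold tourMatrix
  split_ifs
  · exact le_rfl
  · linarith
  · exact div_nonneg one_pos.le (mul_nonneg (by linarith) (by linarith))

theorem sum_tourMatrix_le (C : EdgeSet n) (hn : 3 ≤ n) (v : Fin n) (U : Finset (Fin n)) :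
    ∑ x ∈ U, tourMatrix C v x ≤
      (U.filter fun x => s(v, x) ∈ C).card * (1 - 1 / (n : ℝ)) + 1 / ((n : ℝ) - 2) := by
  have hn' : (3 : ℝ) ≤ n := by exact_mod_cast hn
  have h1 : 0 < 1 / ((n : ℝ) * ((n : ℝ) - 2)) :=
    div_pos one_pos (mul_pos (by linarith) (by linarith))
  have h4 : 1 / (n : ℝ) < 1 := by
    rw [div_lt_one (by linarith)]
    linarith
  have h : ∀ x ∈ U, tourMatrix C v x ≤
      (if s(v, x) ∈ C then 1 - 1 / (n : ℝ) else 0) + 1 / ((n : ℝ) * ((n : ℝ) - 2)) := by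
    intro x _
    unfold tourMatrix
    split_ifs <;> linarith
  refine (Finset.sum_le_sum h).trans ?_
  rw [Finset.sum_add_distrib, ← Finset.sum_filter, Finset.sum_const, Finset.sum_const,
    nsmul_eq_mul, nsmul_eq_mul]
  have hU : (U.card : ℝ) ≤ n := by exact_mod_cast (Finset.card_le_univ U).trans (by simp)
  have : (U.card : ℝ) * (1 / ((n : ℝ) * ((n : ℝ) - 2))) ≤ 1 / ((n : ℝ) - 2) := by
    calc (U.card : ℝ) * (1 / ((n : ℝ) * ((n : ℝ) - 2)))
        ≤ n * (1 / ((n : ℝ) * ((n : ℝ) - 2))) := by gcongr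
      _ = 1 / ((n : ℝ) - 2) := by field_simp
  linarith

/-- The number of edges of the path `v :: l` that do not belong to `C`. -/
def newSteps (C : EdgeSet n) : Fin n → List (Fin n) → ℕ
  | _, [] => 0
  | v, x :: l => (if s(v, x) ∈ C then 0 else 1) + newSteps C x l

theorem newSteps_eq (C : EdgeSet n) : ∀ (v : Fin n) (l : List (Fin n)), (v :: l).Nodup →
    newSteps C v l = (pathEdges (v :: l) \ C).card
  | _, [], _ => by simp [newSteps, pathEdges]
  | v, x :: l, h => by
    have hnot : s(v, x) ∉ pathEdges (x :: l) := fun hm =>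
      (List.nodup_cons.1 h).1 (mem_of_mem_pathEdges hm (by simp))
    rw [newSteps, newSteps_eq C x l (List.nodup_cons.1 h).2, pathEdges]
    split_ifs with hC
    · rw [Finset.insert_sdiff_of_mem _ hC, zero_add]
    · rw [Finset.insert_sdiff_of_notMem _ hC, Finset.card_insert_of_notMem, add_comm]
      simp [hnot]

section Step
variable {C : EdgeSet n} {v x : Fin n} {U : Finset (Fin n)}

theorem sum_tourMatrix_pos (hn : 3 ≤ n) (hx : x ∈ U) (hvx : v ≠ x) :
    0 < ∑ y ∈ U, tourMatrix C v y := by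
  have hn' : (3 : ℝ) ≤ n := by exact_mod_cast hn
  have h4 : 1 / (n : ℝ) < 1 := by
    rw [div_lt_one (by linarith)]
    linarith
  refine Finset.sum_pos' (fun y _ => tourMatrix_nonneg C hn v y) ⟨x, hx, ?_⟩
  unfold tourMatrix
  rw [if_neg hvx]
  split_ifs
  · linarith
  · exact div_pos one_pos (mul_pos (by linarith) (by linarith))

theorem sum_tourMatrix_le_three (hC : IsTour C) (hn : 3 ≤ n) :
    ∑ y ∈ U, tourMatrix C v y ≤ 3 := by
  have hn' : (3 : ℝ) ≤ n := by exact_mod_cast hn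
  have h1 := sum_tourMatrix_le C hn v U
  have h2 : ((U.filter fun x => s(v, x) ∈ C).card : ℝ) ≤ 2 := by
    exact_mod_cast (Finset.card_le_card (Finset.filter_subset_filter _ (Finset.subset_univ U))).trans
      (hC.card_neighbors_le hn v)
  have h3 : 1 / ((n : ℝ) - 2) ≤ 1 := by
    rw [div_le_one (by linarith)]
    linarith
  have h4 : 0 < 1 / (n : ℝ) := div_pos one_pos (by linarith)
  have h5 : 1 / (n : ℝ) < 1 := by
    rw [div_lt_one (by linarith)]
    linarith
  nlinarith

/-- The numerator is at least `1 / n ^ 2`; the total weight is at most three, since `v` has only two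
neighbours in `C`. -/
theorem step_ge_of_notMem (hC : IsTour C) (hn : 3 ≤ n) (hx : x ∈ U) (hvx : v ≠ x)
    (h : s(v, x) ∉ C) : 1 / (3 * (n : ℝ) ^ 2) ≤ tourMatrix C v x / ∑ y ∈ U, tourMatrix C v y := by
  have hn' : (3 : ℝ) ≤ n := by exact_mod_cast hn
  have h1 := sum_tourMatrix_le_three (U := U) (v := v) hC hn
  have h2 : 1 / (n : ℝ) ^ 2 ≤ tourMatrix C v x := by
    rw [tourMatrix, if_neg hvx, if_neg h]
    refine one_div_le_one_div_of_le (mul_pos (by linarith) (by linarith)) ?_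
    nlinarith
  rw [le_div_iff₀ (sum_tourMatrix_pos hn hx hvx)]
  calc 1 / (3 * (n : ℝ) ^ 2) * ∑ y ∈ U, tourMatrix C v y ≤ 1 / (3 * (n : ℝ) ^ 2) * 3 := by gcongr
    _ = 1 / (n : ℝ) ^ 2 := by field_simp
    _ ≤ _ := h2

theorem step_ge_of_mem (hC : IsTour C) (hn : 3 ≤ n) (hx : x ∈ U) (hvx : v ≠ x)
    (h : s(v, x) ∈ C) : 1 / 6 ≤ tourMatrix C v x / ∑ y ∈ U, tourMatrix C v y := by
  have hn' : (3 : ℝ) ≤ n := by exact_mod_cast hn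
  have h1 := sum_tourMatrix_le_three (U := U) (v := v) hC hn
  have h5 : 1 / (n : ℝ) ≤ 1 / 2 := one_div_le_one_div_of_le (by norm_num) (by linarith)
  rw [le_div_iff₀ (sum_tourMatrix_pos hn hx hvx), tourMatrix, if_neg hvx, if_pos h]
  linarith

/-- With one neighbour in `C` visited, only `x` remains as a heavy choice. The total weight is at
most `(1 - 1/n) + 1/(n - 2)`, and the second term is at most `(1 - 1/n) * (4/n)`. -/
theorem step_ge_of_mem_of_visited (hC : IsTour C) (hn : 8 ≤ n) (hx : x ∈ U) (hvx : v ≠ x)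
    (h : s(v, x) ∈ C) {u : Fin n} (hu : u ∉ U) (hvu : s(v, u) ∈ C) :
    (1 + 4 / (n : ℝ))⁻¹ ≤ tourMatrix C v x / ∑ y ∈ U, tourMatrix C v y := by
  have hn' : (8 : ℝ) ≤ n := by exact_mod_cast hn
  have h1 := sum_tourMatrix_le C (by omega) v U
  have h2 : (U.filter fun x => s(v, x) ∈ C).card ≤ 1 := by
    have := hC.card_neighbors_le (by omega) v
    have h3 : (U.filter fun x => s(v, x) ∈ C) ⊂ Finset.univ.filter fun x => s(v, x) ∈ C := by
      refine Finset.ssubset_iff_subset_ne.2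
        ⟨Finset.filter_subset_filter _ (Finset.subset_univ U), fun he => hu ?_⟩
      have : u ∈ Finset.univ.filter fun x => s(v, x) ∈ C := by simp [hvu]
      rw [← he] at this
      exact (Finset.mem_filter.1 this).1
    have := Finset.card_lt_card h3
    omega
  have h2' : ((U.filter fun x => s(v, x) ∈ C).card : ℝ) ≤ 1 := by exact_mod_cast h2
  have h5 : 1 / (n : ℝ) ≤ 1 / 8 := one_div_le_one_div_of_le (by norm_num) hn'
  have h6 : 1 / ((n : ℝ) - 2) ≤ (1 - 1 / (n : ℝ)) * (4 / n) := by
    have : 1 / ((n : ℝ) - 2) ≤ 3 * (1 / n) := by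
      rw [mul_one_div, div_le_div_iff₀ (by linarith) (by linarith)]
      linarith
    have h7 : 0 < 1 / (n : ℝ) := div_pos one_pos (by linarith)
    have h8 : 4 / (n : ℝ) = 4 * (1 / n) := by ring
    rw [h8]
    nlinarith
  rw [le_div_iff₀ (sum_tourMatrix_pos (by omega) hx hvx), inv_mul_le_iff₀ (by positivity),
    tourMatrix, if_neg hvx, if_pos h]
  nlinarith

end Step

/-- A step along `C` is nearly certain if the other neighbour in `C` of the current vertex is
visited, which holds after any step along `C`. It costs `1/6` only at the start or right after a new
edge. The latter loss is charged to the new edge, `1 / (3 n ^ 2) * (1/6) = 1 / (18 n ^ 2)`; the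
former is the leading `1/6` of the first bound. The two bounds are proved together because each
calls on the other. -/
theorem vertexLoop_ge {C : EdgeSet n} (hC : IsTour C) (hn : 8 ≤ n) :
    ∀ (l : List (Fin n)) (k : ℕ) (v : Fin n) (s : List (Fin n)), l.length ≤ k → (v :: l).Nodup →
      1 / 6 * ((1 / (18 * (n : ℝ) ^ 2)) ^ newSteps C v l * ((1 + 4 / (n : ℝ))⁻¹) ^ l.length) ≤
          prob (vertexLoop (tourMatrix C) k v l.toFinset s) {s ++ l} ∧
        ((∃ u, u ∉ l ∧ s(v, u) ∈ C) →
          (1 / (18 * (n : ℝ) ^ 2)) ^ newSteps C v l * ((1 + 4 / (n : ℝ))⁻¹) ^ l.length ≤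
            prob (vertexLoop (tourMatrix C) k v l.toFinset s) {s ++ l})
  | [], k, v, s => by
    intro _ _
    have : vertexLoop (tourMatrix C) k v ([] : List (Fin n)).toFinset s = PMF.pure s := by
      cases k <;> simp [vertexLoop]
    rw [this, prob_pure_of_mem (by simp)]
    norm_num [newSteps]
  | x :: l, 0, v, s => by simp
  | x :: l, k + 1, v, s => by
    intro hk hl
    obtain ⟨hv, hl'⟩ := List.nodup_cons.1 hl
    have hvx : v ≠ x := by rintro rfl; simp at hv
    have hxU : x ∈ (x :: l).toFinset := by simp
    have hn3 : 3 ≤ n := by omega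
    have hn' : (8 : ℝ) ≤ n := by exact_mod_cast hn
    set q := prob (vertexLoop (tourMatrix C) k x l.toFinset (s ++ [x])) {s ++ x :: l} with hq
    have hstep : tourMatrix C v x / (∑ y ∈ (x :: l).toFinset, tourMatrix C v y) * q ≤
        prob (vertexLoop (tourMatrix C) (k + 1) v (x :: l).toFinset s) {s ++ x :: l} := by
      rw [vertexLoop, dif_pos ⟨x, hxU⟩]
      refine le_of_le_of_eq ?_ (prob_pick_bind (w := fun a => tourMatrix C v a) ⟨x, hxU⟩
        (fun a _ => tourMatrix_nonneg C hn3 v a) (sum_tourMatrix_pos hn3 hxU hvx) _ _).symm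
      have he : (x :: l).toFinset.erase x = l.toFinset := by
        rw [List.toFinset_cons, Finset.erase_insert (by simpa using (List.nodup_cons.1 hl').1)]
      have := Finset.single_le_sum (s := (x :: l).toFinset)
        (f := fun a => tourMatrix C v a / (∑ y ∈ (x :: l).toFinset, tourMatrix C v y) *
          prob (vertexLoop (tourMatrix C) k a ((x :: l).toFinset.erase a) (s ++ [a]))
            {s ++ x :: l})
        (fun a _ => mul_nonneg (div_nonneg (tourMatrix_nonneg C hn3 v a)
          (sum_tourMatrix_pos hn3 hxU hvx).le) (prob_nonneg _ _)) hxU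
      simpa only [he] using this
    have ih := vertexLoop_ge hC hn l k x (s ++ [x]) (by simpa using hk) hl'
    rw [List.append_assoc, List.singleton_append, ← hq] at ih
    have hq0 : 0 ≤ q := prob_nonneg _ _
    set η := 1 / (18 * (n : ℝ) ^ 2) with hη
    have hη0 : 0 < η := by positivity
    set γ := (1 + 4 / (n : ℝ))⁻¹ with hγ
    have hγ0 : 0 < γ := by positivity
    have hγ1 : γ ≤ 1 := inv_le_one_of_one_le₀ (by
      have : 0 ≤ 4 / (n : ℝ) := by positivity
      linarith)
    rw [newSteps, List.length_cons]
    by_cases hvC : s(v, x) ∈ C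
    · rw [if_pos hvC, zero_add]
      have h1 := ih.2 ⟨v, fun h => hv (List.mem_cons_of_mem _ h), by rwa [Sym2.eq_swap]⟩
      have h0 : 0 ≤ η ^ newSteps C x l * γ ^ l.length := by positivity
      constructor
      · refine le_trans ?_ hstep
        calc 1 / 6 * (η ^ newSteps C x l * γ ^ (l.length + 1))
            = 1 / 6 * (η ^ newSteps C x l * γ ^ l.length) * γ := by ring
          _ ≤ 1 / 6 * (η ^ newSteps C x l * γ ^ l.length) :=
              mul_le_of_le_one_right (by positivity) hγ1
          _ ≤ _ := mul_le_mul (step_ge_of_mem hC hn3 hxU hvx hvC) h1 h0 (by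
              exact div_nonneg (tourMatrix_nonneg C hn3 v x) (sum_tourMatrix_pos hn3 hxU hvx).le)
      · rintro ⟨u, hu, hvu⟩
        refine le_trans ?_ hstep
        calc η ^ newSteps C x l * γ ^ (l.length + 1)
            = γ * (η ^ newSteps C x l * γ ^ l.length) := by ring
          _ ≤ _ := mul_le_mul (step_ge_of_mem_of_visited hC hn hxU hvx hvC (by simpa using hu) hvu)
              h1 h0 (div_nonneg (tourMatrix_nonneg C hn3 v x) (sum_tourMatrix_pos hn3 hxU hvx).le)
    · rw [if_neg hvC]
      have h0 : 0 ≤ η ^ newSteps C x l * γ ^ l.length := by positivity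
      have key : η ^ (1 + newSteps C x l) * γ ^ (l.length + 1) ≤
          prob (vertexLoop (tourMatrix C) (k + 1) v (x :: l).toFinset s) {s ++ x :: l} := by
        refine le_trans ?_ hstep
        calc η ^ (1 + newSteps C x l) * γ ^ (l.length + 1)
            = η * (η ^ newSteps C x l * γ ^ l.length) * γ := by ring
          _ ≤ η * (η ^ newSteps C x l * γ ^ l.length) :=
              mul_le_of_le_one_right (by positivity) hγ1
          _ = 1 / (3 * (n : ℝ) ^ 2) * (1 / 6 * (η ^ newSteps C x l * γ ^ l.length)) := by
              rw [hη]; field_simp; norm_num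
          _ ≤ _ := mul_le_mul (step_ge_of_notMem hC hn3 hxU hvx hvC) ih.1 (by positivity)
              (div_nonneg (tourMatrix_nonneg C hn3 v x) (sum_tourMatrix_pos hn3 hxU hvx).le)
      refine ⟨le_trans ?_ key, fun _ => key⟩
      have : 0 ≤ η ^ (1 + newSteps C x l) * γ ^ (l.length + 1) := by positivity
      linarith

theorem prob_vertexGen [NeZero n] (P : Matrix (Fin n) (Fin n) ℝ) (S : Set (EdgeSet n)) :
    prob (vertexGen P) S = ∑ v, 1 / (n : ℝ) *
      prob (vertexLoop P n v (Finset.univ.erase v) [v]) (tourEdges ⁻¹' S) := by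
  rw [vertexGen, dif_pos Finset.univ_nonempty, prob_bind]
  refine Finset.sum_congr rfl fun v _ => ?_
  rw [prob_map, PMF.uniformOfFinset_apply_of_mem _ (Finset.mem_univ v)]
  simp

theorem exp_neg_le_inv_pow (hn : 0 < n) {c : ℝ} (hc : 0 ≤ c) {k : ℕ} (hk : k ≤ n) :
    Real.exp (-c) ≤ ((1 + c / (n : ℝ))⁻¹) ^ k := by
  have hn' : (0 : ℝ) < n := by exact_mod_cast hn
  rw [Real.exp_neg, inv_pow]
  refine inv_anti₀ (by positivity) ?_
  calc (1 + c / (n : ℝ)) ^ k ≤ (1 + c / (n : ℝ)) ^ n :=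
        pow_le_pow_right₀ (by have : 0 ≤ c / (n : ℝ) := by positivity
                              linarith) hk
    _ ≤ Real.exp (c / n) ^ n := by
        gcongr
        rw [add_comm]
        exact Real.add_one_le_exp _
    _ = Real.exp c := by rw [← Real.exp_nat_mul]; congr 1; field_simp

theorem prob_vertexLoop_ge {C : EdgeSet n} (hC : IsTour C) (hn : 8 ≤ n) {v : Fin n}
    {l : List (Fin n)} (hl : (v :: l).Nodup) (hm : ∀ w, w ∈ v :: l) :
    Real.exp (-4) / 6 * (1 / (18 * (n : ℝ) ^ 2)) ^ newSteps C v l ≤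
      prob (vertexLoop (tourMatrix C) n v (Finset.univ.erase v) [v])
        (tourEdges ⁻¹' {tourEdges (v :: l)}) := by
  have hlen : l.length + 1 = n := length_eq_of_spanning hl hm
  have h1 := (vertexLoop_ge hC hn l n v [v] (by omega) hl).1
  have hU : l.toFinset = Finset.univ.erase v := by
    ext w
    have := hm w
    have := (List.nodup_cons.1 hl).1
    simp only [List.mem_toFinset, Finset.mem_erase, Finset.mem_univ, and_true]
    grind
  rw [hU] at h1
  refine le_trans ?_ (h1.trans (prob_mono _ fun x _ hx => ?_))
  · have h2 := exp_neg_le_inv_pow (n := n) (by omega) (by norm_num : (0 : ℝ) ≤ 4)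
      (show l.length ≤ n by omega)
    have h3 : 0 ≤ (1 / (18 * (n : ℝ) ^ 2)) ^ newSteps C v l := by positivity
    nlinarith [mul_le_mul_of_nonneg_left h2 h3]
  · rw [Set.mem_singleton_iff] at hx
    rw [hx]
    rfl

/-- From every start vertex, traversing `C` uses no new edge, so the bound survives averaging over
the start. -/
theorem vertexGen_self_ge {C : EdgeSet n} (hC : IsTour C) (hn : 8 ≤ n) :
    Real.exp (-4) / 6 ≤ prob (vertexGen (tourMatrix C)) {C} := by
  have : NeZero n := ⟨by omega⟩
  rw [prob_vertexGen]
  have hn' : (8 : ℝ) ≤ n := by exact_mod_cast hn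
  calc Real.exp (-4) / 6 = ∑ _v : Fin n, 1 / (n : ℝ) * (Real.exp (-4) / 6) := by
        rw [Finset.sum_const, Finset.card_univ, Fintype.card_fin, nsmul_eq_mul]
        field_simp
    _ ≤ _ := by
        refine Finset.sum_le_sum fun v _ => ?_
        obtain ⟨l, hl, hm, hCl⟩ := hC.exists_cons v
        have h := prob_vertexLoop_ge hC hn hl hm
        have h0 : newSteps C v l = 0 := by
          rw [newSteps_eq C v l hl, Finset.card_eq_zero, Finset.sdiff_eq_empty_iff_subset, hCl,
            tourEdges_cons]
          exact Finset.subset_insert _ _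
        rw [h0, pow_zero, mul_one, ← hCl] at h
        gcongr

/-- Starting at an end point of a new edge makes it the closing edge, which is added without a
random choice. At most two new steps remain; the start costs `1/n`, and `1944 = 6 * 18 ^ 2`. -/
theorem vertexGen_improve_ge {C : EdgeSet n} (hC : IsTour C) (hn : 8 ≤ n) (hne : C ≠ sStar n) :
    Real.exp (-4) / 1944 / (n : ℝ) ^ 5 ≤
      prob (vertexGen (tourMatrix C)) {C' | excess C' < excess C} := by
  have : NeZero n := ⟨by omega⟩
  have hn' : (8 : ℝ) ≤ n := by exact_mod_cast hn
  obtain ⟨C', hC', hlt, hcard⟩ := hC.exists_improvement (by omega) hne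
  have hpos : (C' \ C).Nonempty := by
    rw [Finset.sdiff_nonempty]
    intro hsub
    rw [hC'.eq_of_subset hC (by omega) hsub] at hlt
    exact hlt.false
  obtain ⟨e, he⟩ := hpos
  rw [Finset.mem_sdiff] at he
  obtain ⟨v, l, hl, hm, hCl, hev⟩ := hC'.exists_closing he.1
  have hz : newSteps C v l ≤ 2 := by
    rw [newSteps_eq C v l hl]
    have h1 : e ∉ pathEdges (v :: l) := by
      have hlen : l.length + 1 = n := length_eq_of_spanning hl hm
      obtain ⟨a, b, c, l', h⟩ := exists_cons_cons_cons (l := v :: l)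
        (by rw [List.length_cons]; omega)
      obtain ⟨rfl, rfl⟩ : v = a ∧ l = b :: c :: l' := by simpa using h
      rw [hev]
      exact closing_notMem hl
    have h2 : insert e (pathEdges (v :: l) \ C) ⊆ C' \ C := by
      intro x hx
      rw [Finset.mem_insert, Finset.mem_sdiff] at hx
      rw [Finset.mem_sdiff]
      rcases hx with rfl | hx
      · exact he
      · refine ⟨?_, hx.2⟩
        rw [hCl, tourEdges_cons]
        exact Finset.mem_insert_of_mem hx.1
    have h3 := Finset.card_le_card h2
    rw [Finset.card_insert_of_notMem (by simp [h1])] at h3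
    omega
  have h := prob_vertexLoop_ge hC hn hl hm
  have hη1 : 1 / (18 * (n : ℝ) ^ 2) ≤ 1 := by
    rw [div_le_one (by positivity)]
    nlinarith
  have hη := pow_le_pow_of_le_one (by positivity : 0 ≤ 1 / (18 * (n : ℝ) ^ 2)) hη1 hz
  rw [prob_vertexGen]
  calc Real.exp (-4) / 1944 / (n : ℝ) ^ 5
      = 1 / (n : ℝ) * (Real.exp (-4) / 6 * (1 / (18 * (n : ℝ) ^ 2)) ^ 2) := by
        field_simp; norm_num
    _ ≤ 1 / (n : ℝ) * (Real.exp (-4) / 6 * (1 / (18 * (n : ℝ) ^ 2)) ^ newSteps C v l) := by gcongr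
    _ ≤ 1 / (n : ℝ) * prob (vertexLoop (tourMatrix C) n v (Finset.univ.erase v) [v])
        (tourEdges ⁻¹' {C' | excess C' < excess C}) := by
        gcongr
        refine h.trans (prob_mono _ fun x _ hx => ?_)
        simp only [Set.mem_preimage, Set.mem_singleton_iff] at hx
        simp only [Set.mem_preimage, Set.mem_ofPred_eq, hx, ← hCl]
        exact hlt
    _ ≤ _ := Finset.single_le_sum (f := fun v => 1 / (n : ℝ) *
        prob (vertexLoop (tourMatrix C) n v (Finset.univ.erase v) [v])
          (tourEdges ⁻¹' {C' | excess C' < excess C}))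
        (fun w _ => mul_nonneg (by positivity) (prob_nonneg _ _)) (Finset.mem_univ v)

/-! ### Edge-based generation -/

theorem edgeWeight_tourMatrix {C : EdgeSet n} {e : Sym2 (Fin n)} (he : ¬ e.IsDiag) :
    edgeWeight (tourMatrix C) e =
      if e ∈ C then 2 * (1 - 1 / (n : ℝ)) else 2 * (1 / ((n : ℝ) * ((n : ℝ) - 2))) := by
  induction e with
  | h x y =>
    have hxy : x ≠ y := by simpa using he
    simp only [edgeWeight, Sym2.lift_mk, tourMatrix, if_neg hxy, if_neg hxy.symm,
      Sym2.eq_swap (a := y) (b := x)]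
    split_ifs <;> ring

/-- Measured in units of the weight `wC` of an edge of `C`, any other edge weighs at least `1 / n ^
2` and at most `2 / n ^ 2`. There are at most `4 * m ^ 2` admissible edges and `m ≤ n`, so the total
is at most `c + 8 * m / n`. -/
theorem edgeLoop_succ_ge {C : EdgeSet n} (hn : 8 ≤ n) (hB : LinForest B) {m : ℕ}
    (hm : B.card + m = n) {c : ℕ} (hc : (admissible B ∩ C).card ≤ c) {A : EdgeSet n}
    (hA : A ⊆ admissible B) (k : ℕ) (S : Set (EdgeSet n)) :
    ∑ e ∈ A, (if e ∈ C then 1 else 1 / (n : ℝ) ^ 2) / (c + 8 * m / n) *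
        prob (edgeLoop (tourMatrix C) k (insert e B)) S ≤
      prob (edgeLoop (tourMatrix C) (k + 1) B) S := by
  rcases A.eq_empty_or_nonempty with rfl | hne
  · simpa using prob_nonneg _ _
  have hne' := hne.mono hA
  have hn' : (8 : ℝ) ≤ n := by exact_mod_cast hn
  set w := edgeWeight (tourMatrix C) with hw
  set wC := 2 * (1 - 1 / (n : ℝ)) with hwC
  set wN := 2 * (1 / ((n : ℝ) * ((n : ℝ) - 2))) with hwN
  have hwC0 : 0 < wC := by
    have : 1 / (n : ℝ) ≤ 1 / 8 := one_div_le_one_div_of_le (by norm_num) hn'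
    rw [hwC]; linarith
  have hwN0 : 0 < wN :=
    mul_pos two_pos (div_pos one_pos (mul_pos (by linarith) (by linarith)))
  have hwe : ∀ e ∈ admissible B, w e = if e ∈ C then wC else wN := fun e he =>
    edgeWeight_tourMatrix (((mem_admissible_iff hB).1 he).2.1 e (Finset.mem_insert_self _ _))
  have hpos : ∀ e ∈ admissible B, 0 < w e := by
    intro e he
    rw [hwe e he]
    split_ifs <;> assumption
  have hsum : 0 < ∑ b ∈ admissible B, w b := Finset.sum_pos hpos hne'
  have hNC : (n : ℝ) * wN ≤ wC * (2 / n) := by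
    have h2 : 0 < (n : ℝ) - 2 := by linarith
    rw [hwN, hwC, show (n : ℝ) * (2 * (1 / ((n : ℝ) * ((n : ℝ) - 2)))) = 2 / ((n : ℝ) - 2) by
      field_simp, show 2 * (1 - 1 / (n : ℝ)) * (2 / n) = (4 * n - 4) / (n : ℝ) ^ 2 by
      field_simp; ring, div_le_div_iff₀ h2 (by positivity)]
    nlinarith
  have hCN : wC * (1 / (n : ℝ) ^ 2) ≤ wN := by
    have h2 : 0 < (n : ℝ) - 2 := by linarith
    rw [hwN, hwC, show 2 * (1 - 1 / (n : ℝ)) * (1 / (n : ℝ) ^ 2) = (2 * n - 2) / (n : ℝ) ^ 3 by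
      field_simp, mul_one_div, div_le_div_iff₀ (by positivity) (by positivity)]
    nlinarith [sq_nonneg (n : ℝ)]
  have hmn : (m : ℝ) ≤ n := by exact_mod_cast (by omega : m ≤ n)
  have hW : ∑ b ∈ admissible B, w b ≤ wC * (c + 8 * m / n) := by
    calc ∑ b ∈ admissible B, w b ≤ ∑ b ∈ admissible B, ((if b ∈ C then wC else 0) + wN) := by
          refine Finset.sum_le_sum fun b hb => ?_
          rw [hwe b hb]
          split_ifs <;> linarith
      _ = (admissible B ∩ C).card * wC + (admissible B).card * wN := by
          rw [Finset.sum_add_distrib, ← Finset.sum_filter, Finset.filter_mem_eq_inter,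
            Finset.sum_const, Finset.sum_const, nsmul_eq_mul, nsmul_eq_mul]
      _ ≤ c * wC + (4 * (m : ℝ) ^ 2) * wN := by
          have h1 : ((admissible B ∩ C).card : ℝ) ≤ c := by exact_mod_cast hc
          have h2 : ((admissible B).card : ℝ) ≤ 4 * (m : ℝ) ^ 2 := by
            exact_mod_cast hB.card_admissible_le hm
          gcongr
      _ ≤ c * wC + 4 * m * (wC * (2 / n)) := by
          have : (m : ℝ) * wN ≤ wC * (2 / n) := (by gcongr : (m : ℝ) * wN ≤ n * wN).trans hNC
          have h0 : (0 : ℝ) ≤ 4 * m := by positivity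
          nlinarith [mul_le_mul_of_nonneg_left this h0]
      _ = wC * (c + 8 * m / n) := by ring
  have hden : 0 < (c : ℝ) + 8 * m / n := by
    by_contra! h
    nlinarith
  rw [edgeLoop, dif_pos hne']
  refine le_of_le_of_eq ?_ (prob_pick_bind (w := w) hne' (fun a ha => (hpos a ha).le) hsum _ _).symm
  refine le_trans (Finset.sum_le_sum fun e he => ?_) (Finset.sum_le_sum_of_subset_of_nonneg hA
    fun e he _ => mul_nonneg (div_nonneg (hpos e he).le hsum.le) (prob_nonneg _ _))
  refine mul_le_mul_of_nonneg_right ?_ (prob_nonneg _ _)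
  rw [div_le_div_iff₀ hden hsum, hwe e (hA he)]
  split_ifs
  · linarith
  · calc 1 / (n : ℝ) ^ 2 * ∑ b ∈ admissible B, w b ≤ 1 / (n : ℝ) ^ 2 * (wC * (c + 8 * m / n)) := by
          gcongr
      _ = wC * (1 / (n : ℝ) ^ 2) * (c + 8 * m / n) := by ring
      _ ≤ _ := by gcongr

/-- Two edges of `C` must be missing: the last one would close the cycle. -/
theorem IsTour.sdiff_subset_admissible {C : EdgeSet n} (hC : IsTour C) (hn : 3 ≤ n) (hBC : B ⊆ C)
    (hcard : B.card + 2 ≤ n) : C \ B ⊆ admissible B := by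
  have hlt : ∀ B' ⊆ C, B'.card + 1 ≤ n → LinForest B' := fun B' h h' =>
    hC.linForest_of_ssubset (Finset.ssubset_iff_subset_ne.2 ⟨h, by
      rintro rfl
      rw [hC.card hn] at h'
      omega⟩)
  intro x hx
  rw [Finset.mem_sdiff] at hx
  refine (mem_admissible_iff (hlt B hBC (by omega))).2 ⟨hx.2, hlt _ ?_ ?_⟩
  · exact Finset.insert_subset hx.1 hBC
  · rw [Finset.card_insert_of_notMem hx.2]
    omega

theorem inv_mul_inv_eq (m : ℕ) (c : ℝ) :
    (m : ℝ)⁻¹ * (1 + c / (n : ℝ))⁻¹ = 1 / (m + c * m / n) := by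
  rw [← mul_inv, one_div]
  congr 1
  ring

/-- With `m` edges of `C` missing, all `m` are admissible and the total normalised weight is at most
`m * (1 + 8/n)`; so each pass stays inside `C` with probability at least `(1 + 8/n)⁻¹`. -/
theorem edgeLoop_subset_ge {C : EdgeSet n} (hC : IsTour C) (hn : 8 ≤ n) : ∀ (k : ℕ) (B : EdgeSet n),
    B ⊂ C → ((1 + 8 / (n : ℝ))⁻¹) ^ k ≤ prob (edgeLoop (tourMatrix C) k B) {B' | B' ⊆ C}
  | 0, B, hB => by
    rw [edgeLoop, prob_pure_of_mem (by exact hB.1)]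
    simp
  | k + 1, B, hB => by
    have hLF := hC.linForest_of_ssubset hB
    have hn' : (8 : ℝ) ≤ n := by exact_mod_cast hn
    have hγ0 : 0 < (1 + 8 / (n : ℝ))⁻¹ := by positivity
    have hγ1 : (1 + 8 / (n : ℝ))⁻¹ ≤ 1 := inv_le_one_of_one_le₀ (by
      have : 0 ≤ 8 / (n : ℝ) := by positivity
      linarith)
    by_cases hne : (admissible B).Nonempty
    · obtain ⟨e, he⟩ := hne
      obtain ⟨he1, he2⟩ := (mem_admissible_iff hLF).1 he
      have hcard := he2.card_add_one_le (by omega)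
      rw [Finset.card_insert_of_notMem he1] at hcard
      have hA := hC.sdiff_subset_admissible (by omega) hB.1 (by omega)
      have hcC : (C \ B).card = n - B.card := by
        rw [Finset.card_sdiff_of_subset hB.1, hC.card (by omega)]
      obtain ⟨m, hm⟩ : ∃ m, B.card + m = n := ⟨n - B.card, by omega⟩
      have hm0 : 0 < m := by omega
      have hc : (admissible B ∩ C).card ≤ m := by
        rw [show m = (C \ B).card by omega]
        refine Finset.card_le_card fun x hx => ?_
        rw [Finset.mem_inter] at hx
        exact Finset.mem_sdiff.2 ⟨hx.2, ((mem_admissible_iff hLF).1 hx.1).1⟩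
      refine le_trans ?_ (edgeLoop_succ_ge hn hLF hm hc hA k {B' | B' ⊆ C})
      calc ((1 + 8 / (n : ℝ))⁻¹) ^ (k + 1)
          = ∑ e ∈ C \ B, (m : ℝ)⁻¹ * (1 + 8 / (n : ℝ))⁻¹ * ((1 + 8 / (n : ℝ))⁻¹) ^ k := by
            rw [Finset.sum_const, hcC, show n - B.card = m by omega, nsmul_eq_mul]
            have : (m : ℝ) ≠ 0 := by positivity
            rw [← mul_assoc, ← mul_assoc, mul_inv_cancel₀ this, one_mul, pow_succ']
        _ ≤ _ := by
            refine Finset.sum_le_sum fun e he => ?_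
            have heC := (Finset.mem_sdiff.1 he).1
            have heB := (Finset.mem_sdiff.1 he).2
            rw [if_pos heC, inv_mul_inv_eq]
            refine mul_le_mul_of_nonneg_left (edgeLoop_subset_ge hC hn k _ ?_) (by positivity)
            refine Finset.ssubset_iff_subset_ne.2 ⟨Finset.insert_subset heC hB.1, fun h => ?_⟩
            have := congrArg Finset.card h
            rw [Finset.card_insert_of_notMem heB, hC.card (by omega)] at this
            omega
    · rw [edgeLoop, dif_neg hne, prob_pure_of_mem (by exact hB.1)]
      exact pow_le_one₀ hγ0.le hγ1

/-- A Hamiltonian path inside `C` misses exactly one edge of `C`, whose ends have degree one in it.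
-/
theorem closePath_eq_of_subset {C : EdgeSet n} (hC : IsTour C) (hn : 3 ≤ n) (hB : LinForest B)
    (ha : admissible B = ∅) (hBC : B ⊆ C) : closePath B = C := by
  refine (hC.eq_of_subset (isTour_closePath hB ha hn) hn fun x hx => ?_).symm
  obtain ⟨l, hl, hm, hBl⟩ := exists_eq_pathEdges hB ha (by omega)
  have hcard : B.card + 1 = n := by
    rw [hBl, card_pathEdges hl, length_eq_of_spanning hl hm]
    omega
  by_cases hxB : x ∈ B
  · exact subset_closePath hxB
  · have hins : insert x B = C := Finset.eq_of_subset_of_card_le (Finset.insert_subset hx hBC)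
      (by rw [hC.card hn, Finset.card_insert_of_notMem hxB]; omega)
    rw [closePath, Finset.mem_union, Finset.mem_filter]
    refine Or.inr ⟨Finset.mem_univ _, hC.isDiag hn x hx, fun v hv => ?_⟩
    have := hC.deg_eq hn v
    rw [← hins, deg_insert hxB, if_pos hv] at this
    omega

theorem edgeGen_self_ge {C : EdgeSet n} (hC : IsTour C) (hn : 8 ≤ n) :
    Real.exp (-8) ≤ prob (edgeGen (tourMatrix C)) {C} := by
  rw [edgeGen, prob_map]
  have h0 : ∅ ⊂ C := by
    rw [Finset.empty_ssubset, ← Finset.card_pos, hC.card (by omega)]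
    omega
  refine (exp_neg_le_inv_pow (n := n) (by omega) (by norm_num) le_rfl).trans
    ((edgeLoop_subset_ge hC hn n ∅ h0).trans (prob_mono _ fun B hB hBC => ?_))
  obtain ⟨-, h1, h2⟩ := mem_support_edgeLoop _ (by omega) n ∅ B LinForest.empty (by omega) hB
  exact closePath_eq_of_subset hC (by omega) h1 h2 hBC

section Exchange
variable {C : EdgeSet n} {e : Sym2 (Fin n)}

/-- The linear forest obtained from the exchange. -/
def Exchange.target (E : Exchange C e) : EdgeSet n := insert e (C \ E.D)

/-- Once `e`, `p` and `q` are placed, both ends of `e` have degree two, so `a` and `b` are blocked.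
This is why an exchange records the kept edges. -/
theorem Exchange.notMem_admissible (E : Exchange C e) (hB : LinForest B)
    (h : insert e {E.p, E.q} ⊆ B) : E.a ∉ admissible B ∧ E.b ∉ admissible B := by
  simp only [Finset.insert_subset_iff, Finset.singleton_subset_iff] at h
  obtain ⟨he, hp, hq⟩ := h
  have hpD := (Finset.mem_sdiff.1 E.p_mem)
  have hqD := (Finset.mem_sdiff.1 E.q_mem)
  have key : ∀ {x p i}, x ∈ E.D → i ∈ x → i ∈ e → i ∈ p → p ∈ B → p ∈ C → x ≠ p →
      x ∉ admissible B := by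
    intro x p i hx hix hie hip hpB hpC hxp hadm
    have hxC := (Finset.mem_sdiff.1 (E.subset hx)).1
    have h3 := ((mem_admissible_iff hB).1 hadm).2.3 i
    have hsub : {x, p, e} ⊆ (insert x B).filter fun y => i ∈ y := by
      intro y hy
      simp only [Finset.mem_insert, Finset.mem_singleton] at hy
      rw [Finset.mem_filter, Finset.mem_insert]
      rcases hy with rfl | rfl | rfl
      exacts [⟨Or.inl rfl, hix⟩, ⟨Or.inr hpB, hip⟩, ⟨Or.inr he, hie⟩]
    have := Finset.card_le_card hsub
    rw [Finset.card_eq_three.2 ⟨x, p, e, hxp, by rintro rfl; exact E.e_notMem hxC,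
      by rintro rfl; exact E.e_notMem hpC, rfl⟩] at this
    unfold deg at h3
    omega
  exact ⟨key E.a_mem E.ia (by simp [E.e_eq]) E.ip hp hpD.1 (by
      intro h
      exact hpD.2 (h ▸ E.a_mem)),
    key E.b_mem E.jb (by simp [E.e_eq]) E.jq hq hqD.1 (by
      intro h
      exact hqD.2 (h ▸ E.b_mem))⟩

theorem Exchange.card_target_ge (E : Exchange C e) (hC : IsTour C) (hn : 3 ≤ n) :
    n ≤ E.target.card + 2 := by
  have := E.card_le
  rw [target, Finset.card_insert_of_notMem (by simp [E.e_notMem]),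
    Finset.card_sdiff_of_subset (E.subset.trans Finset.sdiff_subset), hC.card hn]
  omega

/-- Since `a` and `b` are blocked, at most one edge of `C` outside the target competes with those
still to be placed. With `r` of them left, the main factor of a pass is `r / (r + 1)`, and the
product telescopes to `1 / (r + 1)`; the light edges only contribute the powers of `(1 + 16/n)⁻¹`.
-/
theorem Exchange.edgeLoop_ge (E : Exchange C e) (hC : IsTour C) (hn : 8 ≤ n) :
    ∀ (r k : ℕ) (B : EdgeSet n), insert e {E.p, E.q} ⊆ B → B ⊆ E.target →
      (E.target \ B).card = r → n ≤ k + B.card + 1 →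
        1 / ((r : ℝ) + 1) * ((1 + 16 / (n : ℝ))⁻¹) ^ r ≤
          prob (edgeLoop (tourMatrix C) k B) {B' | E.target ⊆ B'}
  | 0, k, B => by
    intro _ hB h0 hk
    have hLF : LinForest B := E.linForest.mono hB
    rw [Finset.card_eq_zero, Finset.sdiff_eq_empty_iff_subset] at h0
    rw [prob_eq_one]
    · simp
    · intro B' hB'
      exact h0.trans (mem_support_edgeLoop _ (by omega) k B B' hLF hk hB').1
  | r + 1, k, B => by
    intro hpq hB hr hk
    have hLF : LinForest B := E.linForest.mono hB
    have hn' : (8 : ℝ) ≤ n := by exact_mod_cast hn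
    have hcT := E.card_target_ge hC (by omega)
    have hTn := E.linForest.card_add_one_le (by omega)
    have hsum := Finset.card_sdiff_add_card_eq_card hB
    have hTdef : insert e (C \ E.D) = E.target := rfl
    rw [hTdef] at hTn
    obtain ⟨k, rfl⟩ : ∃ k', k = k' + 1 := ⟨k - 1, by omega⟩
    obtain ⟨m, hm⟩ : ∃ m, B.card + m = n := ⟨n - B.card, by omega⟩
    have hmem : ∀ x ∈ E.target \ B, x ∈ C := by
      intro x hx
      rw [Finset.mem_sdiff, Exchange.target, Finset.mem_insert, Finset.mem_sdiff] at hx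
      rcases hx.1 with rfl | h
      · exact absurd (hpq (by simp)) hx.2
      · exact h.1
    have hA : E.target \ B ⊆ admissible B := by
      intro x hx
      rw [Finset.mem_sdiff] at hx
      exact (mem_admissible_iff hLF).2
        ⟨hx.2, E.linForest.mono (Finset.insert_subset hx.1 hB)⟩
    have hc : (admissible B ∩ C).card ≤ r + 2 := by
      obtain ⟨ha, hb⟩ := E.notMem_admissible hLF hpq
      have hsub : admissible B ∩ C ⊆ (E.target \ B) ∪ (E.D \ {E.a, E.b}) := by
        intro x hx
        rw [Finset.mem_inter] at hx
        have hxB := ((mem_admissible_iff hLF).1 hx.1).1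
        by_cases hxD : x ∈ E.D
        · refine Finset.mem_union_right _ ?_
          simp only [Finset.mem_sdiff, hxD, Finset.mem_insert, Finset.mem_singleton, true_and,
            not_or]
          exact ⟨fun h => ha (h ▸ hx.1), fun h => hb (h ▸ hx.1)⟩
        · refine Finset.mem_union_left _ ?_
          simp [Exchange.target, hx.2, hxD, hxB]
      have h1 := (Finset.card_le_card hsub).trans (Finset.card_union_le _ _)
      rw [hr, Finset.card_sdiff_of_subset (by simp [Finset.insert_subset_iff, E.a_mem, E.b_mem]),
        Finset.card_pair E.ab] at h1
      have := E.card_le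
      omega
    refine le_trans ?_ (edgeLoop_succ_ge hn hLF hm hc hA k _)
    set γ := (1 + 16 / (n : ℝ))⁻¹ with hγ
    have hγ0 : 0 < γ := by positivity
    have hcoef : γ / ((r : ℝ) + 2) ≤ 1 / (((r + 2 : ℕ) : ℝ) + 8 * m / n) := by
      -- The target misses at most two of `n` edges and `r + 1` of its edges are still to be placed.
      -- Then `8 * (r + 3) ≤ 16 * (r + 2)` explains the constant `16`.
      have hm3 : (m : ℝ) ≤ r + 3 := by exact_mod_cast (by omega : m ≤ r + 3)
      rw [hγ, ← one_div, div_div, Nat.cast_add, Nat.cast_two]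
      refine one_div_le_one_div_of_le (by positivity) ?_
      have : 8 * (m : ℝ) / n ≤ 16 / n * (r + 2) := by
        rw [div_mul_eq_mul_div]
        have hr0 : (0 : ℝ) ≤ r := by positivity
        exact div_le_div_of_nonneg_right (by linarith) (by positivity)
      nlinarith
    calc 1 / (((r + 1 : ℕ) : ℝ) + 1) * γ ^ (r + 1)
        = ∑ x ∈ E.target \ B, γ / ((r : ℝ) + 2) * (1 / ((r : ℝ) + 1) * γ ^ r) := by
          rw [Finset.sum_const, hr, nsmul_eq_mul]
          push_cast
          field_simp
          ring
      _ ≤ _ := by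
          refine Finset.sum_le_sum fun x hx => ?_
          rw [if_pos (hmem x hx)]
          have hx' := Finset.mem_sdiff.1 hx
          refine mul_le_mul hcoef (E.edgeLoop_ge hC hn r k _
            (hpq.trans (Finset.subset_insert _ _)) (Finset.insert_subset hx'.1 hB) ?_ ?_)
            (by positivity) (by positivity)
          · rw [Finset.sdiff_insert, Finset.card_erase_of_mem hx, hr]
            rfl
          · rw [Finset.card_insert_of_notMem hx'.2]
            omega

end Exchange

/-! ### Averaging over the subsets of a given size -/

/-- Double counting: each set of size `t + 1` arises from exactly `t + 1` pairs, one per element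
that was inserted last. -/
theorem sum_powersetCard_insert {α : Type*} [DecidableEq α] (C : Finset α) (t : ℕ)
    (f : Finset α → ℝ) :
    ∑ S ∈ C.powersetCard t, ∑ x ∈ C \ S, f (insert x S) =
      (t + 1) * ∑ S ∈ C.powersetCard (t + 1), f S := by
  have h : ((t : ℝ) + 1) * ∑ S ∈ C.powersetCard (t + 1), f S =
      ∑ S ∈ C.powersetCard (t + 1), ∑ _x ∈ S, f S := by
    rw [Finset.mul_sum]
    refine Finset.sum_congr rfl fun S hS => ?_
    rw [Finset.sum_const, (Finset.mem_powersetCard.1 hS).2, nsmul_eq_mul]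
    push_cast
    rfl
  rw [h, Finset.sum_sigma', Finset.sum_sigma']
  refine Finset.sum_bij' (fun p _ => ⟨insert p.2 p.1, p.2⟩) (fun p _ => ⟨p.1.erase p.2, p.2⟩)
    ?_ ?_ ?_ ?_ ?_
  · rintro ⟨S, x⟩ hp
    simp only [Finset.mem_sigma, Finset.mem_powersetCard, Finset.mem_sdiff] at hp ⊢
    obtain ⟨⟨h1, h2⟩, h3, h4⟩ := hp
    exact ⟨⟨Finset.insert_subset h3 h1, by rw [Finset.card_insert_of_notMem h4, h2]⟩, by simp⟩
  · rintro ⟨S, x⟩ hp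
    simp only [Finset.mem_sigma, Finset.mem_powersetCard, Finset.mem_sdiff] at hp ⊢
    obtain ⟨⟨h1, h2⟩, h3⟩ := hp
    exact ⟨⟨(Finset.erase_subset _ _).trans h1, by rw [Finset.card_erase_of_mem h3, h2]; rfl⟩,
      h1 h3, by simp⟩
  · rintro ⟨S, x⟩ hp
    simp only [Finset.mem_sigma, Finset.mem_sdiff] at hp
    simp [Finset.erase_insert hp.2.2]
  · rintro ⟨S, x⟩ hp
    simp only [Finset.mem_sigma] at hp
    simp [Finset.insert_erase hp.2]
  · rintro ⟨S, x⟩ _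
    rfl

theorem choose_succ_le_four_mul {N t : ℕ} (h : N + 1 ≤ 4 * (N + 1 - t)) :
    (N + 1).choose t ≤ 4 * N.choose t := by
  have h1 := Nat.choose_mul_succ_eq N t
  have h2 : (N + 1).choose t * (N + 1) ≤ (4 * N.choose t) * (N + 1) := by
    calc (N + 1).choose t * (N + 1) ≤ (N + 1).choose t * (4 * (N + 1 - t)) :=
          Nat.mul_le_mul_left _ h
      _ = (4 * N.choose t) * (N + 1) := by rw [mul_assoc 4, h1]; ring
  exact Nat.le_of_mul_le_mul_right h2 (Nat.succ_pos _)

theorem choose_succ_succ_le_four_mul {N t : ℕ} (h : N + 1 ≤ 4 * (t + 1)) :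
    (N + 1).choose (t + 1) ≤ 4 * N.choose t := by
  have h1 := Nat.add_one_mul_choose_eq N t
  have h2 : (N + 1).choose (t + 1) * (N + 1) ≤ (4 * N.choose t) * (N + 1) := by
    calc (N + 1).choose (t + 1) * (N + 1) ≤ (N + 1).choose (t + 1) * (4 * (t + 1)) :=
          Nat.mul_le_mul_left _ h
      _ = 4 * ((N + 1).choose (t + 1) * (t + 1)) := by ring
      _ = (4 * N.choose t) * (N + 1) := by
          rw [show (N + 1).choose (t + 1) * (t + 1) = (N + 1) * N.choose t from h1.symm]
          ring
  exact Nat.le_of_mul_le_mul_right h2 (Nat.succ_pos _)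

/-- Forbidding an element (three times) or forcing one (twice) costs a factor of at most four each,
as `t` lies between a quarter and half of `n`; `1024 = 4 ^ 5`. -/
theorem choose_le_mul_choose {n t : ℕ} (hn : 8 ≤ n) (h1 : n < 4 * t) (h2 : 2 * t ≤ n) :
    n.choose t ≤ 1024 * (n - 5).choose (t - 2) := by
  obtain ⟨N, rfl⟩ : ∃ N, n = N + 5 := ⟨n - 5, by omega⟩
  obtain ⟨s, rfl⟩ : ∃ s, t = s + 2 := ⟨t - 2, by omega⟩
  have a1 := choose_succ_le_four_mul (N := N + 4) (t := s + 2) (by omega)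
  have a2 := choose_succ_le_four_mul (N := N + 3) (t := s + 2) (by omega)
  have a3 := choose_succ_le_four_mul (N := N + 2) (t := s + 2) (by omega)
  have a4 := choose_succ_succ_le_four_mul (N := N + 1) (t := s + 1) (by omega)
  have a5 := choose_succ_succ_le_four_mul (N := N) (t := s) (by omega)
  simp only [Nat.add_sub_cancel, add_assoc, Nat.reduceAdd] at *
  omega

/-- Among the subsets of size `t` about half the size of `C`, a constant fraction contains two given
elements and avoids three given ones. -/
theorem card_filter_powersetCard_ge {α : Type*} [DecidableEq α] {C P D : Finset α} {n t : ℕ}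
    (hC : C.card = n) (hP : P ⊆ C \ D) (hPc : P.card = 2) (hD : D ⊆ C) (hDc : D.card ≤ 3)
    (hn : 8 ≤ n) (h1 : n < 4 * t) (h2 : 2 * t ≤ n) :
    n.choose t ≤ 1024 * ((C.powersetCard t).filter fun S => P ⊆ S ∧ S ⊆ C \ D).card := by
  refine (choose_le_mul_choose hn h1 h2).trans (Nat.mul_le_mul_left _ ?_)
  have hcard : n - 5 ≤ ((C \ D) \ P).card := by
    rw [Finset.card_sdiff_of_subset hP, Finset.card_sdiff_of_subset hD]
    omega
  refine (Nat.choose_le_choose (t - 2) hcard).trans ?_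
  rw [← Finset.card_powersetCard]
  -- Adjoining `P` to the subsets of size `t - 2` that avoid `D` and `P` is injective into the
  -- required family.
  refine Finset.card_le_card_of_injOn (fun S => S ∪ P) ?_ ?_
  · intro S hS
    rw [Finset.mem_coe, Finset.mem_powersetCard] at hS
    have hsub : S ∪ P ⊆ C \ D := Finset.union_subset (hS.1.trans Finset.sdiff_subset) hP
    rw [Finset.mem_coe, Finset.mem_filter, Finset.mem_powersetCard]
    refine ⟨⟨hsub.trans Finset.sdiff_subset, ?_⟩, Finset.subset_union_right, hsub⟩
    rw [Finset.card_union_of_disjoint, hS.2, hPc]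
    · omega
    · exact (Finset.sdiff_disjoint (s := P)).mono_left hS.1
  · intro S hS S' hS' h
    rw [Finset.mem_coe, Finset.mem_powersetCard] at hS hS'
    have key : ∀ {S}, S ⊆ (C \ D) \ P → (S ∪ P) \ P = S := by
      intro S hS
      rw [Finset.union_sdiff_right]
      exact Finset.sdiff_eq_self_of_disjoint ((Finset.sdiff_disjoint (s := P)).mono_left hS)
    rw [← key hS.1, ← key hS'.1, show S ∪ P = S' ∪ P from h]

/-! ### Improvement by edge-based generation -/

/-- The event that the cycle obtained from a Hamiltonian path is better than `C`. -/
def improving (C : EdgeSet n) : Set (EdgeSet n) := {B | excess (closePath B) < excess C}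

/-- The probability of an improvement from the partial solution `S`. -/
def improveProb (C S : EdgeSet n) : ℝ :=
  prob (edgeLoop (tourMatrix C) (n - S.card) S) (improving C)

theorem improveProb_nonneg (C S : EdgeSet n) : 0 ≤ improveProb C S := prob_nonneg _ _

variable {C : EdgeSet n}

theorem Exchange.improveProb_ge {e : Sym2 (Fin n)} (E : Exchange C e) (hC : IsTour C) (hn : 8 ≤ n)
    {S : EdgeSet n} (hS1 : {E.p, E.q} ⊆ S) (hS2 : S ⊆ C \ E.D) :
    Real.exp (-16) / n ≤ improveProb C (insert e S) := by
  have heS : e ∉ S := fun h => E.e_notMem (Finset.mem_sdiff.1 (hS2 h)).1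
  have hsub : insert e S ⊆ E.target := Finset.insert_subset_insert _ hS2
  have hTn : E.target.card + 1 ≤ n := E.linForest.card_add_one_le (by omega)
  have hle := Finset.card_le_card hsub
  have hr := Finset.card_sdiff_add_card_eq_card hsub
  set r := (E.target \ insert e S).card with hrdef
  rw [Finset.card_insert_of_notMem heS] at hr hle
  have h := E.edgeLoop_ge hC hn r (n - (insert e S).card) (insert e S)
    (Finset.insert_subset_insert _ hS1) hsub rfl (by omega)
  have hn' : (8 : ℝ) ≤ n := by exact_mod_cast hn
  refine le_trans ?_ (h.trans (prob_mono _ fun B hB hBT => ?_))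
  · have h1 := exp_neg_le_inv_pow (n := n) (by omega) (by norm_num : (0 : ℝ) ≤ 16)
      (show r ≤ n by omega)
    have h2 : (r : ℝ) + 1 ≤ n := by exact_mod_cast (by omega : r + 1 ≤ n)
    calc Real.exp (-16) / n = 1 / (n : ℝ) * Real.exp (-16) := by ring
      _ ≤ _ := by gcongr
  · obtain ⟨-, h1, h2⟩ := mem_support_edgeLoop _ (by omega) _ _ B (E.linForest.mono hsub)
      (by omega) hB
    exact E.excess_lt hC (isTour_closePath h1 h2 (by omega)) (by omega)
      (hBT.trans subset_closePath)

/-- There is an exchange with new edge `e` that is compatible with the partial solution `S`. -/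
def Compatible (C : EdgeSet n) (e : Sym2 (Fin n)) (S : EdgeSet n) : Prop :=
  ∃ E : Exchange C e, {E.p, E.q} ⊆ S ∧ S ⊆ C \ E.D

-- Only two kinds of next edge are counted: an edge of `C`, and an optimal edge `e` compatible with
-- `S`. The latter is picked with probability at least `1 / (2 * n ^ 3)`, because the total weight
-- is at most `2 * n`, and then leads to an improvement with probability at least `exp (-16) / n`.
open Classical in
theorem improveProb_ge (hC : IsTour C) (hn : 8 ≤ n) {S : EdgeSet n} (hSC : S ⊆ C) {m : ℕ}
    (hm : S.card + m = n) (hm2 : 2 ≤ m) :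
    (m : ℝ)⁻¹ * (1 + 8 / (n : ℝ))⁻¹ * ∑ x ∈ C \ S, improveProb C (insert x S) +
      ∑ e ∈ sStar n \ C,
        (if Compatible C e S then Real.exp (-16) / (2 * (n : ℝ) ^ 4) else 0) ≤
      improveProb C S := by
  have hn' : (8 : ℝ) ≤ n := by exact_mod_cast hn
  have hss : S ⊂ C := Finset.ssubset_iff_subset_ne.2 ⟨hSC, by
    rintro rfl
    rw [hC.card (by omega)] at hm
    omega⟩
  have hLF := hC.linForest_of_ssubset hss
  have hA := hC.sdiff_subset_admissible (by omega) hSC (by omega)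
  have hc : (admissible S ∩ C).card ≤ m := by
    rw [show m = (C \ S).card by rw [Finset.card_sdiff_of_subset hSC, hC.card (by omega)]; omega]
    refine Finset.card_le_card fun x hx => ?_
    rw [Finset.mem_inter] at hx
    exact Finset.mem_sdiff.2 ⟨hx.2, ((mem_admissible_iff hLF).1 hx.1).1⟩
  have hmpos : (0 : ℝ) < m := by exact_mod_cast (by omega : 0 < m)
  have hmn : (m : ℝ) ≤ n := by exact_mod_cast (by omega : m ≤ n)
  have hbound : ∑ e ∈ admissible S, (if e ∈ C then 1 else 1 / (n : ℝ) ^ 2) / (m + 8 * m / n) *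
      improveProb C (insert e S) ≤ improveProb C S := by
    have h := edgeLoop_succ_ge hn hLF hm hc subset_rfl (n - S.card - 1) (improving C)
    rw [show n - S.card - 1 + 1 = n - S.card by omega] at h
    refine le_of_eq_of_le (Finset.sum_congr rfl fun e he => ?_) h
    rw [improveProb, Finset.card_insert_of_notMem ((mem_admissible_iff hLF).1 he).1, Nat.sub_sub]
  refine le_trans ?_ hbound
  rw [← Finset.sum_inter_add_sum_sdiff (admissible S) C]
  refine add_le_add ?_ ?_
  · rw [Finset.mul_sum]
    refine le_trans (Finset.sum_le_sum fun x hx => ?_) (Finset.sum_le_sum_of_subset_of_nonneg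
      (Finset.subset_inter hA Finset.sdiff_subset) fun x _ _ =>
        mul_nonneg (by positivity) (improveProb_nonneg _ _))
    rw [if_pos (Finset.mem_sdiff.1 hx).1, inv_mul_inv_eq]
  · rw [← Finset.sum_filter]
    refine le_trans (Finset.sum_le_sum fun e he => ?_) (Finset.sum_le_sum_of_subset_of_nonneg
      (fun e he => ?_) fun x _ _ => mul_nonneg (by positivity) (improveProb_nonneg _ _))
    · obtain ⟨he1, E, hE1, hE2⟩ := Finset.mem_filter.1 he
      rw [if_neg (Finset.mem_sdiff.1 he1).2]
      have h1 := E.improveProb_ge hC hn hE1 hE2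
      have h2 : (m : ℝ) + 8 * m / n ≤ 2 * n := by
        have : 8 * (m : ℝ) / n ≤ n := by
          rw [div_le_iff₀ (by linarith)]
          nlinarith
        linarith
      calc Real.exp (-16) / (2 * (n : ℝ) ^ 4)
          = 1 / (n : ℝ) ^ 2 / (2 * n) * (Real.exp (-16) / n) := by field_simp
        _ ≤ _ := by gcongr
    · obtain ⟨he1, E, hE1, hE2⟩ := Finset.mem_filter.1 he
      have heC := (Finset.mem_sdiff.1 he1).2
      exact Finset.mem_sdiff.2 ⟨(mem_admissible_iff hLF).2 ⟨fun h => heC (hSC h),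
        E.linForest.mono (Finset.insert_subset_insert _ hE2)⟩, heC⟩

open Classical in
theorem card_compatible_ge (hC : IsTour C) (hn : 8 ≤ n) {e : Sym2 (Fin n)}
    (he : e ∈ sStar n \ C) {t : ℕ} (h1 : n < 4 * t) (h2 : 2 * t ≤ n) :
    n.choose t ≤ 1024 * ((C.powersetCard t).filter fun S => Compatible C e S).card := by
  rw [Finset.mem_sdiff] at he
  obtain ⟨E⟩ := exists_exchange hC (by omega) he.1 he.2
  refine (card_filter_powersetCard_ge (P := {E.p, E.q}) (hC.card (by omega)) ?_
    (Finset.card_pair E.pq) (E.subset.trans Finset.sdiff_subset) E.card_le hn h1 h2).trans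
    (Nat.mul_le_mul_left _ (Finset.card_le_card ?_))
  · simp only [Finset.insert_subset_iff, Finset.singleton_subset_iff]
    exact ⟨E.p_mem, E.q_mem⟩
  · intro S hS
    rw [Finset.mem_filter] at hS ⊢
    exact ⟨hS.1, E, hS.2⟩

/-- The average probability of an improvement from the partial solutions `S ⊆ C` of size `t`. -/
def avgImprove (C : EdgeSet n) (t : ℕ) : ℝ :=
  (∑ S ∈ C.powersetCard t, improveProb C S) / n.choose t

theorem avgImprove_nonneg (C : EdgeSet n) (t : ℕ) : 0 ≤ avgImprove C t :=
  div_nonneg (Finset.sum_nonneg fun _ _ => improveProb_nonneg _ _) (by positivity)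

theorem avgImprove_zero (C : EdgeSet n) : avgImprove C 0 = improveProb C ∅ := by
  simp [avgImprove]

-- Averaging closes the recursion: adding a uniform element of `C \ S` to a uniform `S` of size `t`
-- yields a uniform subset of size `t + 1`. The number `b` is a lower bound for the average
-- contribution of compatible edges `e`.
open Classical in
theorem avgImprove_ge (hC : IsTour C) (hn : 8 ≤ n) {t : ℕ} (ht : t + 2 ≤ n) {b : ℝ}
    (hb : b * n.choose t ≤ ∑ S ∈ C.powersetCard t, ∑ e ∈ sStar n \ C,
      (if Compatible C e S then Real.exp (-16) / (2 * (n : ℝ) ^ 4) else 0)) :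
    (1 + 8 / (n : ℝ))⁻¹ * avgImprove C (t + 1) + b ≤ avgImprove C t := by
  obtain ⟨m, hm⟩ : ∃ m, t + m = n := ⟨n - t, by omega⟩
  have hsum := Finset.sum_le_sum fun S (hS : S ∈ C.powersetCard t) =>
    improveProb_ge hC hn (Finset.mem_powersetCard.1 hS).1
      (by rw [(Finset.mem_powersetCard.1 hS).2]; exact hm) (show 2 ≤ m by omega)
  rw [Finset.sum_add_distrib, ← Finset.mul_sum, sum_powersetCard_insert] at hsum
  have hch : 0 < (n.choose t : ℝ) := by exact_mod_cast Nat.choose_pos (by omega)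
  have hch' : 0 < (n.choose (t + 1) : ℝ) := by exact_mod_cast Nat.choose_pos (by omega)
  have hmpos : (0 : ℝ) < m := by exact_mod_cast (by omega : 0 < m)
  have hrel : (n.choose (t + 1) : ℝ) * (t + 1) = n.choose t * m := by
    have := Nat.choose_succ_right_eq n t
    rw [show n - t = m by omega] at this
    exact_mod_cast this
  rw [avgImprove, avgImprove, le_div_iff₀ hch, add_mul]
  refine le_trans (add_le_add (le_of_eq ?_) hb) hsum
  field_simp
  linear_combination (-(∑ S ∈ C.powersetCard (t + 1), improveProb C S)) * hrel

theorem avgImprove_succ_le (hC : IsTour C) (hn : 8 ≤ n) {t : ℕ} (ht : t + 2 ≤ n) :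
    (1 + 8 / (n : ℝ))⁻¹ * avgImprove C (t + 1) ≤ avgImprove C t := by
  classical
  have := avgImprove_ge hC hn ht (b := 0) (by
    rw [zero_mul]
    refine Finset.sum_nonneg fun _ _ => Finset.sum_nonneg fun _ _ => ?_
    split_ifs <;> positivity)
  simpa using this

theorem avgImprove_succ_add_le (hC : IsTour C) (hn : 8 ≤ n) {t : ℕ} (h1 : n < 4 * t)
    (h2 : 2 * t ≤ n) :
    (1 + 8 / (n : ℝ))⁻¹ * avgImprove C (t + 1) +
      excess C * (Real.exp (-16) / (2048 * (n : ℝ) ^ 4)) ≤ avgImprove C t := by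
  classical
  refine avgImprove_ge hC hn (by omega) ?_
  rw [Finset.sum_comm]
  calc (excess C : ℝ) * (Real.exp (-16) / (2048 * (n : ℝ) ^ 4)) * n.choose t
      = ∑ _e ∈ sStar n \ C, Real.exp (-16) / (2048 * (n : ℝ) ^ 4) * n.choose t := by
        rw [Finset.sum_const, hC.card_sStar_sdiff (by omega), nsmul_eq_mul, mul_assoc]
    _ ≤ _ := by
        refine Finset.sum_le_sum fun e he => ?_
        rw [← Finset.sum_filter, Finset.sum_const, nsmul_eq_mul]
        have h : (n.choose t : ℝ) ≤
            1024 * ((C.powersetCard t).filter fun S => Compatible C e S).card := by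
          exact_mod_cast card_compatible_ge hC hn he h1 h2
        calc Real.exp (-16) / (2048 * (n : ℝ) ^ 4) * n.choose t
            ≤ Real.exp (-16) / (2048 * (n : ℝ) ^ 4) *
              (1024 * ((C.powersetCard t).filter fun S => Compatible C e S).card) := by gcongr
          _ = _ := by ring

/-- Each size `t` with `n/4 < t ≤ n/2` contributes a gain of order `excess C / n ^ 4`, discounted by
at most a constant for having stayed inside `C` so far; there are order `n` such sizes. -/
theorem edgeGen_improve_ge (hC : IsTour C) (hn : 8 ≤ n) :
    Real.exp (-24) / 16384 * excess C / (n : ℝ) ^ 3 ≤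
      prob (edgeGen (tourMatrix C)) {C' | excess C' < excess C} := by
  have hn' : (8 : ℝ) ≤ n := by exact_mod_cast hn
  set γ := (1 + 8 / (n : ℝ))⁻¹ with hγ
  have hγ0 : 0 < γ := by positivity
  have hγ1 : γ ≤ 1 := inv_le_one_of_one_le₀ (by
    have : 0 ≤ 8 / (n : ℝ) := by positivity
    linarith)
  set b := (excess C : ℝ) * (Real.exp (-16) / (2048 * (n : ℝ) ^ 4)) with hb
  have hb0 : 0 ≤ b := by positivity
  have h1 : ∀ j, j + 1 ≤ n → γ ^ j * avgImprove C j ≤ avgImprove C 0 := by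
    intro j
    induction j with
    | zero => simp
    | succ j ih =>
      intro hj
      refine le_trans ?_ (ih (by omega))
      rw [pow_succ, mul_assoc]
      exact mul_le_mul_of_nonneg_left (avgImprove_succ_le hC hn (by omega)) (by positivity)
  -- Unrolls the recursion over the sizes from `n / 4 + 1` to `n / 2`, collecting one gain `b` per
  -- size; all discounts are weakened to `γ ^ n`.
  have h2 : ∀ j, n / 4 + j ≤ n / 2 →
      γ ^ (n / 4 + 1 + j) * avgImprove C (n / 4 + 1 + j) + j * (γ ^ n * b) ≤ avgImprove C 0 := by
    intro j
    induction j with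
    | zero =>
      intro _
      simpa using h1 (n / 4 + 1) (by omega)
    | succ j ih =>
      intro hj
      refine le_trans ?_ (ih (by omega))
      have h := avgImprove_succ_add_le (t := n / 4 + 1 + j) hC hn (by omega) (by omega)
      have h3 := mul_le_mul_of_nonneg_left h (by positivity : 0 ≤ γ ^ (n / 4 + 1 + j))
      have h4 : γ ^ n * b ≤ γ ^ (n / 4 + 1 + j) * b := by
        refine mul_le_mul_of_nonneg_right ?_ hb0
        exact pow_le_pow_of_le_one hγ0.le hγ1 (by omega)
      rw [← add_assoc (n / 4 + 1), pow_succ]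
      push_cast
      nlinarith
  have h3 := h2 (n / 2 - n / 4) (by omega)
  have h4 : (n : ℝ) / 8 ≤ ((n / 2 - n / 4 : ℕ) : ℝ) := by
    rw [div_le_iff₀ (by norm_num)]
    exact_mod_cast (by omega : n ≤ (n / 2 - n / 4) * 8)
  have h5 : Real.exp (-8) ≤ γ ^ n :=
    exp_neg_le_inv_pow (n := n) (by omega) (by norm_num : (0 : ℝ) ≤ 8) le_rfl
  have h6 : avgImprove C 0 = prob (edgeGen (tourMatrix C)) {C' | excess C' < excess C} := by
    rw [avgImprove_zero, improveProb, edgeGen, prob_map]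
    rfl
  rw [← h6]
  refine le_trans ?_ h3
  have h7 : 0 ≤ γ ^ (n / 4 + 1 + (n / 2 - n / 4)) *
      avgImprove C (n / 4 + 1 + (n / 2 - n / 4)) := mul_nonneg (by positivity) (avgImprove_nonneg _ _)
  refine le_trans ?_ (le_add_of_nonneg_left h7)
  -- At least `n / 8` gains, each discounted by `exp (-8)`; `16384 = 8 * 2048`.
  calc Real.exp (-24) / 16384 * excess C / (n : ℝ) ^ 3 = n / 8 * (Real.exp (-8) * b) := by
        rw [hb, show (-24 : ℝ) = -8 + -16 by norm_num, Real.exp_add]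
        field_simp
        ring
    _ ≤ _ := by gcongr

/-! ### Runs of the algorithm -/

section Run
variable {N : ℕ} (gen : Matrix (Fin n) (Fin n) ℝ → PMF (EdgeSet n))
  (sort : (Fin N → EdgeSet n) → Equiv.Perm (Fin N))

/-- The probability that the optimal tour is not sampled within `T` iterations from `P`. -/
def failProb (T : ℕ) (P : Matrix (Fin n) (Fin n) ℝ) : ℝ :=
  prob (ceRun gen 1 1 (1 / ((n : ℝ) * ((n : ℝ) - 2))) (1 - 1 / (n : ℝ)) sort T P)
    {r | ∃ X ∈ r, ∃ i, X i = sStar n}ᶜ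

theorem successProb_eq (T : ℕ) : successProb gen sort T = 1 - failProb gen sort T (initDist n) :=
  eq_sub_of_add_eq (prob_add_prob_compl _ _)

theorem failProb_le_one (T : ℕ) (P : Matrix (Fin n) (Fin n) ℝ) : failProb gen sort T P ≤ 1 :=
  prob_le_one _ _

open Classical in
theorem failProb_succ (hn : 3 ≤ n) (hN : 0 < N) (T : ℕ) (P : Matrix (Fin n) (Fin n) ℝ) :
    failProb gen sort (T + 1) P = ∑ X, (iid (gen P) N X).toReal *
      if ∃ i, X i = sStar n then 0
      else failProb gen sort T (tourMatrix (X (sort X ⟨0, hN⟩))) := by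
  rw [failProb, ceRun, prob_bind]
  refine Finset.sum_congr rfl fun X _ => ?_
  rw [prob_map, nextDist_eq_tourMatrix hn hN]
  congr 1
  split_ifs with h
  · have : (fun r => X :: r) ⁻¹' {r : List (Fin N → EdgeSet n) | ∃ X ∈ r, ∃ i, X i = sStar n}ᶜ =
        ∅ := by
      ext r
      simp [h]
    rw [this]
    simp [prob]
  · rw [failProb]
    congr 1
    ext r
    simp only [Set.mem_preimage, Set.mem_compl_iff, Set.mem_ofPred_eq, List.mem_cons,
      exists_eq_or_imp, h, false_or]

theorem failProb_succ_le (hn : 3 ≤ n) (hN : 0 < N) (T : ℕ) (P : Matrix (Fin n) (Fin n) ℝ) :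
    failProb gen sort (T + 1) P ≤ failProb gen sort T P := by
  induction T generalizing P with
  | zero =>
    have : failProb gen sort 0 P = 1 := prob_pure_of_mem (by simp)
    rw [this]
    exact failProb_le_one _ _ _ _
  | succ T ih =>
    rw [failProb_succ gen sort hn hN, failProb_succ gen sort hn hN]
    refine Finset.sum_le_sum fun X _ => mul_le_mul_of_nonneg_left ?_ ENNReal.toReal_nonneg
    split_ifs
    · exact le_rfl
    · exact ih _

theorem failProb_antitone (hn : 3 ≤ n) (hN : 0 < N) (P : Matrix (Fin n) (Fin n) ℝ) :
    Antitone fun T => failProb gen sort T P :=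
  antitone_nat_of_succ_le fun T => failProb_succ_le gen sort hn hN T P

variable {gen sort}

/-- Used for the initial matrix: the first iteration is spent only on obtaining some tour, of which
nothing is assumed. -/
theorem failProb_succ_le_of_forall (hn : 3 ≤ n) (hN : 0 < N)
    (hgen : ∀ P, ∀ C ∈ (gen P).support, IsTour C) {T : ℕ} {U : ℝ} (hU0 : 0 ≤ U)
    (hU : ∀ C, IsTour C → C ≠ sStar n → failProb gen sort T (tourMatrix C) ≤ U)
    (P : Matrix (Fin n) (Fin n) ℝ) : failProb gen sort (T + 1) P ≤ U := by
  classical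
  rw [failProb_succ gen sort hn hN]
  calc _ ≤ ∑ X, (iid (gen P) N X).toReal * U := by
        refine Finset.sum_le_sum fun X _ => ?_
        by_cases hX : X ∈ (iid (gen P) N).support
        · refine mul_le_mul_of_nonneg_left ?_ ENNReal.toReal_nonneg
          split_ifs with h
          · exact hU0
          · exact hU _ (hgen P _ (mem_support_iid hX _)) fun h' => h ⟨_, h'⟩
        · rw [PMF.mem_support_iff, not_not] at hX
          simp [hX]
    _ = U := by rw [← Finset.sum_mul, sum_toReal, one_mul]

theorem prob_iid_compl_le (p : PMF (EdgeSet n)) (S : Set (EdgeSet n)) {c : ℝ} (hc : c ≤ prob p S)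
    (N : ℕ) : prob (iid p N) {X | ∀ i, X i ∈ Sᶜ} ≤ Real.exp (-(c * N)) := by
  rw [prob_iid_forall]
  have h := prob_add_prob_compl p S
  calc prob p Sᶜ ^ N ≤ Real.exp (-c) ^ N := by
        refine pow_le_pow_left₀ (prob_nonneg _ _) ?_ N
        have := Real.add_one_le_exp (-c)
        linarith
    _ = Real.exp (-(c * N)) := by
        rw [← Real.exp_nat_mul]
        congr 1
        ring

/-- The sorting rule selects a solution of least excess. -/
theorem excess_best_le (hn : 3 ≤ n) (hN : 0 < N) (hsort : IsSortRule (cost (distG1 n)) sort)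
    {X : Fin N → EdgeSet n} (hX : ∀ i, IsTour (X i)) (i : Fin N) :
    excess (X (sort X ⟨0, hN⟩)) ≤ excess (X i) := by
  refine (hX i).excess_le_of_cost_le (hX _) hn ?_
  have h := hsort X (show (⟨0, hN⟩ : Fin N) ≤ (sort X).symm i from Nat.zero_le _)
  simpa using h

/-- If some sample improves on `C`, the bound `U` applies. If none does but `C` is resampled, the
selected tour has at most the excess of `C`, though by a tie it may be another tour, and `U + Δ`
applies. Otherwise the bound one is used, and this costs the probability of not resampling `C`. -/
theorem failProb_step (hn : 3 ≤ n) (hN : 0 < N) (hsort : IsSortRule (cost (distG1 n)) sort)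
    (hgen : ∀ P, ∀ C ∈ (gen P).support, IsTour C) {C : EdgeSet n} {p₀ p₁ U Δ : ℝ} {T : ℕ}
    (h₀ : p₀ ≤ prob (gen (tourMatrix C)) {C})
    (h₁ : p₁ ≤ prob (gen (tourMatrix C)) {C' | excess C' < excess C})
    (hU0 : 0 ≤ U) (hΔ0 : 0 ≤ Δ)
    (hU : ∀ C', IsTour C' → C' ≠ sStar n → excess C' < excess C →
      failProb gen sort T (tourMatrix C') ≤ U)
    (hΔ : ∀ C', IsTour C' → C' ≠ sStar n → excess C' ≤ excess C →
      failProb gen sort T (tourMatrix C') ≤ U + Δ) :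
    failProb gen sort (T + 1) (tourMatrix C) ≤
      Real.exp (-(p₀ * N)) + U + Real.exp (-(p₁ * N)) * Δ := by
  classical
  rw [failProb_succ gen sort hn hN]
  set μ := iid (gen (tourMatrix C)) N with hμ
  set A : Set (Fin N → EdgeSet n) := {X | ∀ i, X i ∈ ({C} : Set (EdgeSet n))ᶜ} with hA
  set I : Set (Fin N → EdgeSet n) := {X | ∀ i, X i ∈ {C' : EdgeSet n | excess C' < excess C}ᶜ}
    with hI
  calc _ ≤ ∑ X, (μ X).toReal * ((if X ∈ A then 1 else 0) + U + (if X ∈ I then 1 else 0) * Δ) := by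
        refine Finset.sum_le_sum fun X _ => ?_
        by_cases hX : X ∈ μ.support
        · have hT : ∀ i, IsTour (X i) := fun i => hgen _ _ (mem_support_iid hX i)
          refine mul_le_mul_of_nonneg_left ?_ ENNReal.toReal_nonneg
          have hbest := excess_best_le hn hN hsort hT
          have hA0 : (0 : ℝ) ≤ if X ∈ A then 1 else 0 := by split_ifs <;> norm_num
          have hI0 : (0 : ℝ) ≤ (if X ∈ I then 1 else 0) * Δ := by split_ifs <;> simp [hΔ0]
          by_cases h : ∃ i, X i = sStar n
          · rw [if_pos h]
            linarith
          rw [if_neg h]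
          have hne : X (sort X ⟨0, hN⟩) ≠ sStar n := fun h' => h ⟨_, h'⟩
          by_cases hXI : X ∈ I
          · by_cases hXA : X ∈ A
            · rw [if_pos hXA]
              have := failProb_le_one gen sort T (tourMatrix (X (sort X ⟨0, hN⟩)))
              linarith
            · rw [if_pos hXI]
              obtain ⟨i, hi⟩ : ∃ i, X i = C := by simpa [hA] using hXA
              have := hΔ _ (hT _) hne (hi ▸ hbest i)
              linarith
          · obtain ⟨i, hi⟩ : ∃ i, excess (X i) < excess C := by simpa [hI] using hXI
            have := hU _ (hT _) hne ((hbest i).trans_lt hi)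
            linarith
        · rw [PMF.mem_support_iff, not_not] at hX
          simp [hX]
    _ = prob μ A + U + prob μ I * Δ := by
        rw [prob_eq_sum μ A, prob_eq_sum μ I]
        simp only [mul_add, Finset.sum_add_distrib]
        rw [← Finset.sum_mul, sum_toReal, one_mul, Finset.sum_mul]
        simp only [mul_assoc]
    _ ≤ _ := by
        have a1 := prob_iid_compl_le _ _ h₀ N
        have a2 := prob_iid_compl_le _ _ h₁ N
        have a3 := mul_le_mul_of_nonneg_right a2 hΔ0
        linarith

/-- Induction on the level, with `τ l` iterations reserved for level `l`. Each iteration risks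
losing the current tour, with probability `exp (-(p₀ * N))`; each level risks not being left in
time, with probability at most `exp (-(c * N))`. -/
theorem failProb_le (hn : 3 ≤ n) (hN : 0 < N) (hsort : IsSortRule (cost (distG1 n)) sort)
    (hgen : ∀ P, ∀ C ∈ (gen P).support, IsTour C) {p₀ c : ℝ} {p : ℕ → ℝ} {τ : ℕ → ℕ}
    (h₀ : ∀ C, IsTour C → p₀ ≤ prob (gen (tourMatrix C)) {C})
    (h₁ : ∀ C, IsTour C → C ≠ sStar n →
      p (excess C) ≤ prob (gen (tourMatrix C)) {C' | excess C' < excess C})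
    (hp : ∀ l, 0 ≤ p l) (hc : ∀ l, 0 < l → c ≤ p l * τ l) (k : ℕ) :
    ∀ C, IsTour C → C ≠ sStar n → excess C ≤ k →
      failProb gen sort (∑ l ∈ Finset.range k, τ (l + 1)) (tourMatrix C) ≤
        (∑ l ∈ Finset.range k, τ (l + 1) : ℕ) * Real.exp (-(p₀ * N)) +
          k * Real.exp (-(c * N)) := by
  induction k with
  | zero =>
    intro C hC hne h
    exact absurd ((hC.excess_eq_zero_iff hn).1 (Nat.le_zero.1 h)) hne
  | succ k ih =>
    set Tk := ∑ l ∈ Finset.range k, τ (l + 1) with hTk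
    set q := Real.exp (-(p₀ * N)) with hq
    set ρ := Real.exp (-(c * N)) with hρ
    set r := Real.exp (-(p (k + 1) * N)) with hr
    have hr1 : r ≤ 1 := by
      rw [hr, Real.exp_le_one_iff]
      have := mul_nonneg (hp (k + 1)) (Nat.cast_nonneg (α := ℝ) N)
      linarith
    have hr0 : 0 < r := Real.exp_pos _
    have hq0 : 0 < q := Real.exp_pos _
    have hρ0 : 0 < ρ := Real.exp_pos _
    -- Inner induction on the number `s` of iterations available at level `k + 1`: the extra failure
    -- is at most `s * q` for losing the tour plus `r ^ s` for never improving.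
    have hinner : ∀ s : ℕ, ∀ C, IsTour C → C ≠ sStar n → excess C ≤ k + 1 →
        failProb gen sort (Tk + s) (tourMatrix C) ≤ (Tk * q + k * ρ) + (s * q + r ^ s) := by
      intro s
      induction s with
      | zero =>
        intro C _ _ _
        refine (failProb_le_one _ _ _ _).trans ?_
        rw [pow_zero]
        have : 0 ≤ Tk * q + k * ρ + ((0 : ℕ) : ℝ) * q := by positivity
        linarith
      | succ s ihs =>
        intro C hC hne hk
        -- Levels may be left early or skipped; by monotonicity in the number of iterations, the
        -- spare ones do no harm.
        have hlow : ∀ C', IsTour C' → C' ≠ sStar n → excess C' ≤ k → ∀ s : ℕ,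
            failProb gen sort (Tk + s) (tourMatrix C') ≤ Tk * q + k * ρ := fun C' h1 h2 h3 s =>
          (failProb_antitone gen sort hn hN _ (Nat.le_add_right Tk s)).trans (ih C' h1 h2 h3)
        rcases Nat.le_or_eq_of_le_succ hk with hk | hk
        · have := hlow C hC hne hk (s + 1)
          have h2 : 0 ≤ ((s + 1 : ℕ) : ℝ) * q + r ^ (s + 1) := by positivity
          linarith
        · have hstep := failProb_step (T := Tk + s) (U := Tk * q + k * ρ) (Δ := s * q + r ^ s)
            hn hN hsort hgen (h₀ C hC) (h₁ C hC hne) (by positivity) (by positivity)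
            (fun C' h1 h2 h3 => hlow C' h1 h2 (by omega) s)
            (fun C' h1 h2 h3 => ihs C' h1 h2 (by omega))
          rw [hk, ← hq, Nat.succ_eq_add_one, ← hr] at hstep
          rw [← add_assoc]
          refine hstep.trans ?_
          have : r * (s * q) ≤ s * q := mul_le_of_le_one_left (by positivity) hr1
          rw [pow_succ]
          push_cast
          linarith
    intro C hC hne hk
    have h := hinner (τ (k + 1)) C hC hne hk
    rw [Finset.sum_range_succ, ← hTk]
    refine h.trans ?_
    have : r ^ τ (k + 1) ≤ ρ := by
      rw [hr, hρ, ← Real.exp_nat_mul, Real.exp_le_exp]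
      have := mul_le_mul_of_nonneg_right (hc (k + 1) (Nat.succ_pos _)) (Nat.cast_nonneg (α := ℝ) N)
      linarith
    push_cast
    linarith

end Run

/-! ### From the failure bound to the running times -/

theorem eventually_two_mul_pow_le_exp {ε a : ℝ} (hε : 0 < ε) (ha : 0 < a) :
    ∀ᶠ n : ℕ in atTop, 2 * (n : ℝ) ^ 6 ≤ Real.exp (a * (n : ℝ) ^ ε) := by
  -- The exponent seven is six for the power and one for the factor `2 ≤ n`.
  have h := ((isLittleO_log_rpow_atTop hε).bound (by positivity : 0 < a / 7)).natCast_atTop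
  filter_upwards [h, eventually_ge_atTop 2] with n hn hn2
  have hn' : (2 : ℝ) ≤ n := by exact_mod_cast hn2
  have hlog : 0 ≤ Real.log n := Real.log_nonneg (by linarith)
  have hr : 0 ≤ (n : ℝ) ^ ε := by positivity
  rw [Real.norm_of_nonneg hlog, Real.norm_of_nonneg hr] at hn
  calc 2 * (n : ℝ) ^ 6 ≤ n * (n : ℝ) ^ 6 := by gcongr
    _ = Real.exp (7 * Real.log n) := by
        rw [mul_comm (7 : ℝ), Real.exp_mul, Real.exp_log (by linarith)]
        norm_cast
        ring
    _ ≤ _ := by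
        rw [Real.exp_le_exp]
        linarith

/-- The runtime bound for a method of random solution generation that reproduces the current tour
with constant probability `p₀` and improves a tour of excess `l` with probability `p n l`. -/
theorem successProb_ge (gen : ∀ n, Matrix (Fin n) (Fin n) ℝ → PMF (EdgeSet n)) {p₀ c : ℝ}
    {p : ℕ → ℕ → ℝ} {τ : ℕ → ℕ → ℕ} {T : ℕ → ℕ} (hp₀ : 0 < p₀) (hc0 : 0 < c)
    (hgen : ∀ n, 8 ≤ n → ∀ P, ∀ C ∈ (gen n P).support, IsTour C)
    (h₀ : ∀ n, 8 ≤ n → ∀ C, IsTour C → p₀ ≤ prob (gen n (tourMatrix C)) {C})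
    (h₁ : ∀ n, 8 ≤ n → ∀ C, IsTour C → C ≠ sStar n →
      p n (excess C) ≤ prob (gen n (tourMatrix C)) {C' | excess C' < excess C})
    (hp : ∀ n l, 0 ≤ p n l) (hc : ∀ n, 8 ≤ n → ∀ l, 0 < l → c ≤ p n l * τ n l)
    (hT : ∀ n, 8 ≤ n → ∑ l ∈ Finset.range n, τ n (l + 1) + 1 ≤ T n)
    (hT6 : ∀ n, 8 ≤ n → T n ≤ n ^ 6)
    {ε : ℝ} (hε : 0 < ε) {N : ℕ → ℕ} (hN : InOmega (fun n => (N n : ℝ)) fun n => (n : ℝ) ^ ε) :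
    ∃ g : ℕ → ℝ, InOmega g (fun n => (N n : ℝ)) ∧ ∀ᶠ n : ℕ in atTop,
      ∀ sort : (Fin (N n) → EdgeSet n) → Equiv.Perm (Fin (N n)),
        IsSortRule (cost (distG1 n)) sort →
          1 - Real.exp (-g n) ≤ successProb (gen n) sort (T n) := by
  obtain ⟨c', hc', hN⟩ := hN
  set b := min p₀ c with hb
  have hb0 : 0 < b := lt_min hp₀ hc0
  -- Half of the exponent `b * N n` is spent on absorbing the polynomial factor `2 * n ^ 6`.
  refine ⟨fun n => b / 2 * N n, ⟨b / 2, by positivity, by simp⟩, ?_⟩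
  filter_upwards [hN, eventually_ge_atTop 8,
    eventually_two_mul_pow_le_exp hε (by positivity : 0 < b / 2 * c')] with n hNn hn hexp sort hsort
  have hn' : (8 : ℝ) ≤ n := by exact_mod_cast hn
  have hN0 : 0 < N n := by
    have : 0 < c' * (n : ℝ) ^ ε := by positivity
    exact_mod_cast this.trans_le hNn
  set S := ∑ l ∈ Finset.range n, τ n (l + 1) with hS
  have hfail := failProb_succ_le_of_forall (T := S) (sort := sort) (by omega) hN0 (hgen n hn)
    (U := S * Real.exp (-(p₀ * N n)) + n * Real.exp (-(c * N n))) (by positivity)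
    (fun C hC hne => failProb_le (by omega) hN0 hsort (hgen n hn) (h₀ n hn) (h₁ n hn) (hp n)
      (hc n hn) n C hC hne (by
        have := hC.excess_add (by omega)
        omega)) (initDist n)
  have hfail' := (failProb_antitone (gen n) sort (by omega) hN0 (initDist n) (hT n hn)).trans hfail
  rw [successProb_eq]
  refine sub_le_sub_left (hfail'.trans ?_) 1
  have hS6 : (S : ℝ) ≤ (n : ℝ) ^ 6 := by
    exact_mod_cast (by have := hT n hn; have := hT6 n hn; omega : S ≤ n ^ 6)
  have hn6 : (n : ℝ) ≤ (n : ℝ) ^ 6 := le_self_pow₀ (by linarith) (by norm_num)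
  have e1 : Real.exp (-(p₀ * N n)) ≤ Real.exp (-(b * N n)) := by
    rw [Real.exp_le_exp]
    have : b * N n ≤ p₀ * N n := by gcongr; exact min_le_left _ _
    linarith
  have e2 : Real.exp (-(c * N n)) ≤ Real.exp (-(b * N n)) := by
    rw [Real.exp_le_exp]
    have : b * N n ≤ c * N n := by gcongr; exact min_le_right _ _
    linarith
  calc S * Real.exp (-(p₀ * N n)) + n * Real.exp (-(c * N n))
      ≤ (n : ℝ) ^ 6 * Real.exp (-(b * N n)) + (n : ℝ) ^ 6 * Real.exp (-(b * N n)) := by gcongr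
    _ = 2 * (n : ℝ) ^ 6 * Real.exp (-(b * N n)) := by ring
    _ ≤ Real.exp (b / 2 * c' * (n : ℝ) ^ ε) * Real.exp (-(b * N n)) := by gcongr
    _ ≤ Real.exp (-(b / 2 * N n)) := by
        rw [← Real.exp_add, Real.exp_le_exp]
        have := mul_le_mul_of_nonneg_left hNn (by positivity : 0 ≤ b / 2)
        nlinarith

theorem one_le_log {n : ℕ} (hn : 8 ≤ n) : 1 ≤ Real.log n := by
  have hn' : (8 : ℝ) ≤ n := by exact_mod_cast hn
  rw [Real.le_log_iff_exp_le (by linarith)]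
  have := Real.exp_one_lt_d9
  linarith

/-- The harmonic sum gives `n ^ 3 / 4 * (1 + log n)`, which is at most `n ^ 3 * log n / 2` since
`log n ≥ 1`. The other half covers the rounding and the first iteration. -/
theorem sum_ceil_le {n : ℕ} (hn : 8 ≤ n) :
    ∑ l ∈ Finset.range n, ⌈(n : ℝ) ^ 3 / (4 * (l + 1 : ℕ))⌉₊ + 1 ≤
      ⌊(n : ℝ) ^ 3 * Real.log n⌋₊ := by
  refine Nat.le_floor ?_
  have hn' : (8 : ℝ) ≤ n := by exact_mod_cast hn
  have hlog := one_le_log hn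
  have hH : ∑ l ∈ Finset.range n, ((l + 1 : ℕ) : ℝ)⁻¹ ≤ 1 + Real.log n := by
    have := harmonic_le_one_add_log n
    rw [harmonic] at this
    push_cast at this ⊢
    exact this
  have h : (∑ l ∈ Finset.range n, (⌈(n : ℝ) ^ 3 / (4 * (l + 1 : ℕ))⌉₊ : ℝ)) ≤
      (n : ℝ) ^ 3 / 4 * (1 + Real.log n) + n := by
    calc _ ≤ ∑ l ∈ Finset.range n, ((n : ℝ) ^ 3 / 4 * ((l + 1 : ℕ) : ℝ)⁻¹ + 1) := by
          refine Finset.sum_le_sum fun l _ => ?_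
          refine (Nat.ceil_lt_add_one (by positivity)).le.trans (le_of_eq ?_)
          field_simp
      _ = (n : ℝ) ^ 3 / 4 * (∑ l ∈ Finset.range n, ((l + 1 : ℕ) : ℝ)⁻¹) + n := by
          rw [Finset.sum_add_distrib, ← Finset.mul_sum]
          simp
      _ ≤ _ := by gcongr
  rw [Nat.cast_add, Nat.cast_sum, Nat.cast_one]
  have h3 : 64 * (n : ℝ) ≤ (n : ℝ) ^ 3 := by
    have := mul_nonneg (by linarith : 0 ≤ (n : ℝ) - 8) (by linarith : 0 ≤ (n : ℝ))
    nlinarith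
  have h4 : (n : ℝ) ^ 3 * 1 ≤ (n : ℝ) ^ 3 * Real.log n := by gcongr
  nlinarith

end CETSP

end

theorem mainTheorem2 (ε : ℝ) (hε0 : 0 < ε) (hε1 : ε < 1) (N : ℕ → ℕ)
    (hN : CETSP.InOmega (fun n => (N n : ℝ)) (fun n => (n : ℝ) ^ ε)) :
    (∃ g : ℕ → ℝ, CETSP.InOmega g (fun n => (N n : ℝ)) ∧
      ∀ᶠ n : ℕ in Filter.atTop,
        ∀ sort : (Fin (N n) → CETSP.EdgeSet n) → Equiv.Perm (Fin (N n)),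
          CETSP.IsSortRule (CETSP.cost (CETSP.distG1 n)) sort →
            1 - Real.exp (-g n) ≤
              CETSP.successProb CETSP.vertexGen sort (n ^ 6)) ∧
    (∃ g : ℕ → ℝ, CETSP.InOmega g (fun n => (N n : ℝ)) ∧
      ∀ᶠ n : ℕ in Filter.atTop,
        ∀ sort : (Fin (N n) → CETSP.EdgeSet n) → Equiv.Perm (Fin (N n)),
          CETSP.IsSortRule (CETSP.cost (CETSP.distG1 n)) sort →
            1 - Real.exp (-g n) ≤
              CETSP.successProb CETSP.edgeGen sort ⌊(n : ℝ) ^ 3 * Real.log n⌋₊) := by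
  constructor
  · refine CETSP.successProb_ge (fun n => CETSP.vertexGen) (p₀ := Real.exp (-4) / 6)
      (c := Real.exp (-4) / 3888) (p := fun n _ => Real.exp (-4) / 1944 / (n : ℝ) ^ 5)
      -- Subtracting one makes room for the first iteration: `n * (n ^ 5 - 1) + 1 ≤ n ^ 6`. It at
      -- most halves `p * τ`, and `3888 = 2 * 1944`.
      (τ := fun n _ => n ^ 5 - 1) (T := fun n => n ^ 6) (by positivity) (by positivity)
      (fun n hn P C hC => CETSP.isTour_of_mem_support_vertexGen (by omega) P hC)
      (fun n hn C hC => CETSP.vertexGen_self_ge hC hn)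
      (fun n hn C hC hne => CETSP.vertexGen_improve_ge hC hn hne)
      (fun n l => by positivity) (fun n hn l _ => ?_) (fun n hn => ?_) (fun n _ => le_rfl) hε0 hN
    · have h1 : 8 ^ 5 ≤ n ^ 5 := Nat.pow_le_pow_left hn 5
      have h2 : (n : ℝ) ^ 5 / 2 ≤ ((n ^ 5 - 1 : ℕ) : ℝ) := by
        rw [div_le_iff₀ (by norm_num)]
        exact_mod_cast (by omega : n ^ 5 ≤ (n ^ 5 - 1) * 2)
      have hn' : (0 : ℝ) < n := by exact_mod_cast (by omega : 0 < n)
      calc Real.exp (-4) / 3888 = Real.exp (-4) / 1944 / (n : ℝ) ^ 5 * ((n : ℝ) ^ 5 / 2) := by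
            field_simp
            norm_num
        _ ≤ _ := by gcongr
    · simp only [Finset.sum_const, Finset.card_range, smul_eq_mul]
      have h1 : 8 ^ 6 ≤ n ^ 6 := Nat.pow_le_pow_left hn 6
      have h2 : n * (n ^ 5 - 1) = n ^ 6 - n := by
        rw [Nat.mul_sub, mul_one]
        congr 1
        ring
      have h3 : n ≤ n ^ 6 := Nat.le_self_pow (by norm_num) n
      omega
  · refine CETSP.successProb_ge (fun n => CETSP.edgeGen) (p₀ := Real.exp (-8))
      (c := Real.exp (-24) / 65536)
      (p := fun n l => Real.exp (-24) / 16384 * l / (n : ℝ) ^ 3)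
      -- Inversely proportional to `l`, so that `p * τ` is bounded below independently of the level;
      -- `65536 = 4 * 16384`.
      (τ := fun n l => ⌈(n : ℝ) ^ 3 / (4 * l)⌉₊) (by positivity) (by positivity)
      (fun n hn P C hC => CETSP.isTour_of_mem_support_edgeGen (by omega) P hC)
      (fun n hn C hC => CETSP.edgeGen_self_ge hC hn)
      (fun n hn C hC _ => CETSP.edgeGen_improve_ge hC hn)
      (fun n l => by positivity) (fun n hn l hl => ?_) (fun n hn => CETSP.sum_ceil_le hn)
      (fun n hn => ?_) hε0 hN
    · have hn' : (0 : ℝ) < n := by exact_mod_cast (by omega : 0 < n)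
      have hl' : (0 : ℝ) < l := by exact_mod_cast hl
      calc Real.exp (-24) / 65536
          = Real.exp (-24) / 16384 * l / (n : ℝ) ^ 3 * ((n : ℝ) ^ 3 / (4 * l)) := by
            field_simp
            norm_num
        _ ≤ _ := by
            gcongr
            exact Nat.le_ceil _
    · refine Nat.floor_le_of_le ?_
      have hn' : (8 : ℝ) ≤ n := by exact_mod_cast hn
      have hlog : Real.log n ≤ n := (Real.log_le_sub_one_of_pos (by linarith)).trans (by linarith)
      push_cast
      calc (n : ℝ) ^ 3 * Real.log n ≤ (n : ℝ) ^ 3 * (n : ℝ) := by gcongr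
        _ = (n : ℝ) ^ 4 := by ring
        _ ≤ (n : ℝ) ^ 6 := pow_le_pow_right₀ (by linarith) (by norm_num)
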